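/- Let $p\ge 1$ be an integer. Observe $y\mid\beta\sim N_p(\beta,I_p)$ and estimate $\beta\in\mathbb R^p$ under the quadratic loss $\|\hat\beta-\beta\|^2$. An estimator is minimax if its maximal risk over $\beta$ equals the infimum of the maximal risks of all estimators. Consider the hierarchical, possibly improper, prior $\beta\mid\kappa\sim N_p(0,\kappa^{-1}(1-\kappa)I_p)$ with $$\pi(\kappa)=\kappa^{a-1}(1-\kappa)^{b-1}h(\kappa),\qquad h(\kappa)=\{1+c_1\log(1/\kappa)\}^{c_2},\qquad 0<\kappa<1,$$ where $c_1>0$ and $-p/2\le a<p/2-2$; if $a=-p/2$, suppose moreover that $\int_0^1\kappa^{-1}h(\kappa)\,d\kappa<\infty$ (equivalently, $c_2<-1$). The (generalized) Bayes estimator is the posterior mean $E[\beta\mid y]$; it is well defined if, for every $y$, the marginal density of $y$ is positive and finite and the posterior has a mean. 1. If $0<c_2\le (p/2+a+2)/c_1$ and $$\frac{p+2a+2}{3p/2+a}\le b<1,$$ then the (generalized) Bayes estimator is well defined and minimax. 2. If $-(p/2-a-2)/(2c_1)<c_2<0$ and $$\frac{p+2a+2-2c_1c_2}{3p/2+a}\le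 b<1,$$ then the (generalized) Bayes estimator is well defined and minimax. In particular, if $p\ge5$, $a=0$, $c_2=-2$, $c_1=(p-4)/16$ and $\frac{5p+4}{6p}\le b<1$, then the prior is proper, that is $0<\int_0^1\pi(\kappa)\,d\kappa<\infty$, and the corresponding proper Bayes estimator is well defined and minimax. -/

import Mathlib

open MeasureTheory ProbabilityTheory
open scoped ENNReal

namespace LogAdjusted

noncomputable section

/-- The space `ℝ^p` with its Euclidean norm. -/
abbrev Vec (p : ℕ) : Type := EuclideanSpace ℝ (Fin p)

/-! ### The estimation problem `y ∣ β ∼ N_p(β, I_p)` under quadratic loss -/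

/-- The sampling model `β ↦ N_p(β, I_p)`, as a Markov kernel. -/
def normalModel (p : ℕ) : Kernel (Vec p) (Vec p) where
  toFun β := multivariateGaussian β 1
  measurable' := by
    have h : (fun β : Vec p => multivariateGaussian β (1 : Matrix (Fin p) (Fin p) ℝ))
        = fun β => (stdGaussian (Vec p)).map (fun x => β + x) := by
      funext β
      simp [multivariateGaussian]
    rw [h]
    refine Measure.measurable_of_measurable_coe _ fun s hs => ?_
    have h2 : ∀ β : Vec p, (stdGaussian (Vec p)).map (fun x => β + x) s
        = stdGaussian (Vec p) (Prod.mk β ⁻¹' ((fun z : Vec p × Vec p => z.1 + z.2) ⁻¹' s)) := by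
      intro β
      rw [Measure.map_apply (by fun_prop) hs]
      rfl
    simp_rw [h2]
    exact measurable_measure_prodMk_left (hs.preimage (by fun_prop))

/-- The quadratic loss `‖d - β‖²` of the decision `d` at the parameter `β`. -/
def quadLoss {p : ℕ} (β d : Vec p) : ℝ≥0∞ := ENNReal.ofReal (‖d - β‖ ^ 2)

/-- The quadratic risk `E ‖δ(Y) - β‖²`, `Y ∼ N_p(β, I_p)`, of the estimator `δ`. -/
def risk {p : ℕ} (δ : Vec p → Vec p) (β : Vec p) : ℝ≥0∞ :=
  ∫⁻ y, quadLoss β (δ y) ∂(normalModel p β)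

/-- `δ` is minimax: its maximal risk is the infimum of the maximal risks of all (possibly
randomized) estimators. -/
def IsMinimax {p : ℕ} (δ : Vec p → Vec p) : Prop :=
  Measurable δ ∧ ⨆ β, risk δ β = minimaxRisk quadLoss (normalModel p)

/-! ### The hierarchical prior and its (generalized) Bayes estimator -/

/-- The density at `x` of the normal distribution `N_p(μ, v I_p)`, `v > 0`. -/
def normalDensity {p : ℕ} (μ : Vec p) (v : ℝ) (x : Vec p) : ℝ :=
  (2 * Real.pi * v) ^ (-(p : ℝ) / 2) * Real.exp (-‖x - μ‖ ^ 2 / (2 * v))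

/-- The log-adjustment `h(κ) = {1 + c₁ log (1/κ)} ^ c₂`. -/
def logAdj (c₁ c₂ κ : ℝ) : ℝ := (1 + c₁ * Real.log (1 / κ)) ^ c₂

/-- The (possibly improper) prior density `κ ^ (a - 1) (1 - κ) ^ (b - 1) h(κ)` on `(0, 1)`. -/
def kappaPrior (a b : ℝ) (h : ℝ → ℝ) (κ : ℝ) : ℝ :=
  κ ^ (a - 1) * (1 - κ) ^ (b - 1) * h κ

/-- A prior density on `(0, 1)` is proper if its total mass is positive and finite. -/
def IsProper (prior : ℝ → ℝ) : Prop :=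
  (∫⁻ κ in Set.Ioo 0 1, ENNReal.ofReal (prior κ)) ≠ 0 ∧
    (∫⁻ κ in Set.Ioo 0 1, ENNReal.ofReal (prior κ)) ≠ ⊤

/-- The prior density of `β` induced by `β ∣ κ ∼ N_p(0, κ⁻¹ (1 - κ) I_p)` and the prior density
`prior` of `κ`. -/
def betaPrior (p : ℕ) (prior : ℝ → ℝ) (β : Vec p) : ℝ≥0∞ :=
  ∫⁻ κ in Set.Ioo 0 1, ENNReal.ofReal (normalDensity 0 (κ⁻¹ * (1 - κ)) β * prior κ)

/-- The marginal density `m(y)` of the data for the prior density `f` on `β`. -/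
def marginal {p : ℕ} (f : Vec p → ℝ≥0∞) (y : Vec p) : ℝ≥0∞ :=
  ∫⁻ β, ENNReal.ofReal (normalDensity β 1 y) * f β

/-- The posterior distribution of `β` given `y` for the prior density `f` on `β`; it is a
probability measure whenever `0 < m(y) < ∞`. -/
def posterior {p : ℕ} (f : Vec p → ℝ≥0∞) (y : Vec p) : Measure (Vec p) :=
  (marginal f y)⁻¹ • volume.withDensity fun β => ENNReal.ofReal (normalDensity β 1 y) * f β

/-- The (generalized) Bayes estimator under quadratic loss: the posterior mean `E[β ∣ y]`. -/
def bayesEstimator {p : ℕ} (f : Vec p → ℝ≥0∞) (y : Vec p) : Vec p :=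
  ∫ β, β ∂(posterior f y)

/-- The (generalized) Bayes estimator exists: at every `y` the marginal density is positive and
finite, and the posterior distribution has a mean. -/
def BayesEstimatorExists {p : ℕ} (f : Vec p → ℝ≥0∞) : Prop :=
  ∀ y, marginal f y ≠ 0 ∧ marginal f y ≠ ⊤ ∧ Integrable (fun β : Vec p => β) (posterior f y)

/-- The (generalized) Bayes estimator with respect to the prior density `prior` of `κ` exists and
is minimax. -/
def BayesMinimax (p : ℕ) (prior : ℝ → ℝ) : Prop :=
  BayesEstimatorExists (betaPrior p prior) ∧ IsMinimax (bayesEstimator (betaPrior p prior))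

end

end LogAdjusted

namespace LogAdjusted

variable {p : ℕ}

/-! ### Normal densities -/

/-! The minimax risk is at least `p`: under the conjugate prior N(0, τI) the posterior variance is
τ/(1+τ) per coordinate, so the Bayes risk is at least pτ/(1+τ), which tends to `p`
(`natCast_le_minimaxRisk`). It remains to show that the Bayes estimator has risk at most `p`
everywhere.

Given κ, the data are N(0, κ⁻¹I) and E[β | y, κ] = (1 - κ)y. Hence the Bayes estimator is (1 -
φ(r))y with r = ‖y‖² and φ = M₁/M₀, where Mⱼ is the j-th moment of κ^(p/2) π(κ) exp(-κr/2)
(`bayesEstimatorExists_and_eq`). Stein's identity reduces the risk bound to rφ² ≤ 2(pφ + 2rφ')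
(`risk_shrinkage_le`). Since φ' = -(M₂M₀ - M₁²)/(2M₀²), this becomes, with z = r/2, the inequality
2zM₂M₀ - zM₁² ≤ pM₁M₀.

To prove it, put s = p/2 + a and c = c₁c₂, and integrate by parts against exp(-zκ) - exp(-z). The
subtracted constant removes the singularity of (1 - κ)^(b-1) at 1. The term carrying 1 - b lies
between 0 and 1 - b times the left side, so b z M₂ ≤ (s+1)P₁ - cQ₁ and sP₀ - cQ₀ ≤ z M₁. Here Pⱼ is
Mⱼ with the kernel reduced by exp(-z), and Qⱼ carries the extra weight 1/(1 + c₁ log(1/κ))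
(`mul_laplaceWeight_le`, `le_mul_laplaceWeight`). The lower bound on `b` absorbs the main term M₁M₀.
The remainders, of order exp(-z) or involving Q, are compared by Chebyshev's integral inequality
(`chebyshev_integral_id`) or, when c₂ < 0, also by 0 ≤ Q ≤ P. -/

lemma normalDensity_pos (μ : Vec p) {v : ℝ} (hv : 0 < v) (x : Vec p) :
    0 < normalDensity μ v x := by
  unfold normalDensity
  have : 0 < 2 * Real.pi * v := by positivity
  positivity

lemma normalDensity_eq_sub (μ : Vec p) (v : ℝ) (x : Vec p) :
    normalDensity μ v x = normalDensity 0 v (x - μ) := by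
  simp [normalDensity]

lemma normalDensity_neg (v : ℝ) (x : Vec p) : normalDensity 0 v (-x) = normalDensity 0 v x := by
  simp [normalDensity]

lemma continuous_normalDensity (μ : Vec p) (v : ℝ) : Continuous (normalDensity μ v) := by
  unfold normalDensity
  fun_prop

lemma measurable_normalDensity_uncurry (p : ℕ) :
    Measurable fun q : (Vec p × ℝ) × Vec p => normalDensity q.1.1 q.1.2 q.2 := by
  unfold normalDensity
  fun_prop

@[fun_prop]
lemma measurable_normalDensity_comp {α : Type*} [MeasurableSpace α] {f g : α → Vec p} {v : α → ℝ}
    (hf : Measurable f) (hv : Measurable v) (hg : Measurable g) :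
    Measurable fun a => normalDensity (f a) (v a) (g a) :=
  (measurable_normalDensity_uncurry p).comp ((hf.prodMk hv).prodMk hg)

lemma integral_normalDensity (μ : Vec p) {v : ℝ} (hv : 0 < v) :
    ∫ x, normalDensity μ v x = 1 := by
  simp_rw [normalDensity_eq_sub μ]
  rw [integral_sub_right_eq_self (fun x => normalDensity 0 v x) μ]
  have h := GaussianFourier.integral_rexp_neg_mul_sq_norm (V := Vec p)
    (show 0 < 1 / (2 * v) by positivity)
  have hp : 0 < 2 * Real.pi * v := by positivity
  simp only [normalDensity, sub_zero, integral_const_mul]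
  have e : ∀ x : Vec p, Real.exp (-‖x‖ ^ 2 / (2 * v)) = Real.exp (-(1 / (2 * v)) * ‖x‖ ^ 2) := by
    intro x; congr 1; ring
  simp_rw [e, h]
  have : Real.pi / (1 / (2 * v)) = 2 * Real.pi * v := by field_simp
  rw [this, ← Real.rpow_add hp]
  simp [neg_div]

lemma integrable_normalDensity (μ : Vec p) {v : ℝ} (hv : 0 < v) :
    Integrable (normalDensity μ v) := by
  -- A non-integrable function has integral 0 by convention, but the integral was computed to be 1.
  by_contra h
  have := integral_normalDensity μ hv
  rw [integral_undef h] at this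
  exact zero_ne_one this

lemma lintegral_normalDensity (μ : Vec p) {v : ℝ} (hv : 0 < v) :
    ∫⁻ x, ENNReal.ofReal (normalDensity μ v x) = 1 := by
  rw [← ofReal_integral_eq_lintegral_ofReal (integrable_normalDensity μ hv)
    (.of_forall fun x => (normalDensity_pos μ hv x).le), integral_normalDensity μ hv,
    ENNReal.ofReal_one]

/-- Half of the Gaussian exponent pays for the quadratic factor, by 1 + t ≤ exp t at t = ‖x -
μ‖²/(4v); the other half is a normal density of variance 2v. -/
lemma normalDensity_mul_normSq_le (μ : Vec p) {v : ℝ} (hv : 0 < v) (x : Vec p) :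
    normalDensity μ v x * ‖x - μ‖ ^ 2
      ≤ ((2 * Real.pi * v) ^ (-(p : ℝ) / 2) / (2 * Real.pi * (2 * v)) ^ (-(p : ℝ) / 2) * (4 * v))
        * normalDensity μ (2 * v) x := by
  have h1 : 0 < (2 * Real.pi * v) ^ (-(p : ℝ) / 2) := by positivity
  have h2 : 0 < (2 * Real.pi * (2 * v)) ^ (-(p : ℝ) / 2) := by positivity
  have e : Real.exp (-‖x - μ‖ ^ 2 / (2 * v)) = Real.exp (-‖x - μ‖ ^ 2 / (2 * (2 * v)))
      * Real.exp (-(‖x - μ‖ ^ 2 / (4 * v))) := by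
    rw [← Real.exp_add]; congr 1; field_simp; ring
  have key : Real.exp (-(‖x - μ‖ ^ 2 / (4 * v))) * ‖x - μ‖ ^ 2 ≤ 4 * v := by
    rw [Real.exp_neg, ← div_eq_inv_mul, div_le_iff₀ (Real.exp_pos _)]
    have := Real.add_one_le_exp (‖x - μ‖ ^ 2 / (4 * v))
    have h3 : ‖x - μ‖ ^ 2 = 4 * v * (‖x - μ‖ ^ 2 / (4 * v)) := by field_simp
    nlinarith
  unfold normalDensity
  rw [e]
  calc _ = (2 * Real.pi * v) ^ (-(p : ℝ) / 2) * Real.exp (-‖x - μ‖ ^ 2 / (2 * (2 * v)))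
        * (Real.exp (-(‖x - μ‖ ^ 2 / (4 * v))) * ‖x - μ‖ ^ 2) := by ring
    _ ≤ (2 * Real.pi * v) ^ (-(p : ℝ) / 2) * Real.exp (-‖x - μ‖ ^ 2 / (2 * (2 * v))) * (4 * v) := by
        gcongr
    _ = _ := by field_simp

lemma integrable_normalDensity_mul_normSq (μ : Vec p) {v : ℝ} (hv : 0 < v) :
    Integrable fun x => normalDensity μ v x * ‖x - μ‖ ^ 2 := by
  refine Integrable.mono' ((integrable_normalDensity μ (show 0 < 2 * v by positivity)).const_mul _)
    ((continuous_normalDensity μ v).mul (by fun_prop)).aestronglyMeasurable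
    (Filter.Eventually.of_forall fun x => (Real.norm_of_nonneg ?_).trans_le
      (normalDensity_mul_normSq_le μ hv x))
  exact mul_nonneg (normalDensity_pos μ hv x).le (by positivity)

/-- Functions of at most quadratic growth are integrable against a normal density. -/
lemma integrable_normalDensity_mul (μ : Vec p) {v : ℝ} (hv : 0 < v) {f : Vec p → ℝ}
    (hf : AEStronglyMeasurable f) {A B : ℝ} (h : ∀ x, |f x| ≤ A + B * ‖x - μ‖ ^ 2) :
    Integrable fun x => normalDensity μ v x * f x := by
  refine (((integrable_normalDensity μ hv).const_mul A).add
    ((integrable_normalDensity_mul_normSq μ hv).const_mul B)).mono'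
    ((continuous_normalDensity μ v).aestronglyMeasurable.mul hf) (.of_forall fun x => ?_)
  rw [norm_mul, Real.norm_of_nonneg (normalDensity_pos μ hv x).le, Real.norm_eq_abs]
  calc _ ≤ normalDensity μ v x * (A + B * ‖x - μ‖ ^ 2) :=
        mul_le_mul_of_nonneg_left (h x) (normalDensity_pos μ hv x).le
    _ = _ := by simp only [Pi.add_apply]; ring

lemma hasFDerivAt_normalDensity (μ : Vec p) (v : ℝ) (x : Vec p) :
    HasFDerivAt (normalDensity μ v)
      ((-(normalDensity μ v x) / v) • (innerSL ℝ (x - μ) : Vec p →L[ℝ] ℝ)) x := by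
  have h1 : HasFDerivAt (fun x : Vec p => ‖x - μ‖ ^ 2) (2 • (innerSL ℝ (x - μ))) x := by
    simpa using ((hasFDerivAt_id x).sub_const μ).norm_sq
  have h2 := ((h1.const_mul (-1 / (2 * v))).exp).const_mul ((2 * Real.pi * v) ^ (-(p : ℝ) / 2))
  have e : normalDensity μ v = fun x => (2 * Real.pi * v) ^ (-(p : ℝ) / 2)
      * Real.exp (-1 / (2 * v) * ‖x - μ‖ ^ 2) := by
    funext x; unfold normalDensity; congr 2; ring
  rw [e]
  refine h2.congr_fderiv ?_
  ext w
  simp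
  field_simp

/-- **Stein's identity**. -/
lemma integral_normalDensity_mul_sub (μ : Vec p) {v : ℝ} (hv : 0 < v) (i : Fin p) {f : Vec p → ℝ}
    {f' : Vec p → Vec p →L[ℝ] ℝ} (hf : ∀ x, HasFDerivAt f (f' x) x)
    (h0 : Integrable fun x => normalDensity μ v x * f x)
    (h1 : Integrable fun x => normalDensity μ v x * (f x * (x i - μ i)))
    (h2 : Integrable fun x => normalDensity μ v x * f' x (EuclideanSpace.single i 1)) :
    ∫ x, normalDensity μ v x * (f x * (x i - μ i))
      = v * ∫ x, normalDensity μ v x * f' x (EuclideanSpace.single i 1) := by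
  have e : ∀ x : Vec p, ((-(normalDensity μ v x) / v) • (innerSL ℝ (x - μ) : Vec p →L[ℝ] ℝ))
      (EuclideanSpace.single i 1) = -(1 / v) * (normalDensity μ v x * (x i - μ i)) := by
    intro x
    simp [EuclideanSpace.inner_single_right]
    ring
  -- Integration by parts in the i-th coordinate direction, where the density has derivative -(xᵢ -
  -- μᵢ)/v times itself.
  have := integral_bilinear_hasFDerivAt_right_eq_neg_left_of_integrable (μ := volume)
    (f := f) (f' := f') (g := normalDensity μ v) (v := EuclideanSpace.single i 1)
    (B := ContinuousLinearMap.mul ℝ ℝ)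
    (g' := fun x => (-(normalDensity μ v x) / v) • (innerSL ℝ (x - μ) : Vec p →L[ℝ] ℝ))
    (by simpa [mul_comm] using h2)
    (by
      simp only [e, ContinuousLinearMap.mul_apply']
      convert h1.const_mul (-(1 / v)) using 2
      ring)
    (by simpa [mul_comm] using h0)
    (fun x _ => hf x) (fun x _ => hasFDerivAt_normalDensity μ v x)
  simp only [e, ContinuousLinearMap.mul_apply'] at this
  have e2 : ∀ x, f x * (-(1 / v) * (normalDensity μ v x * (x i - μ i)))
      = -(1 / v) * (normalDensity μ v x * (f x * (x i - μ i))) := by intro x; ring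
  simp_rw [e2, integral_const_mul, mul_comm _ (normalDensity μ v _)] at this
  field_simp at this
  simp only [mul_assoc] at this
  linarith

lemma abs_apply_le_norm (x : Vec p) (i : Fin p) : |x i| ≤ ‖x‖ := by
  simpa using PiLp.norm_apply_le x i

/-- Stein's identity applied to xᵢ - μᵢ gives variance `v` for each of the `p` coordinates. -/
lemma integral_normalDensity_mul_normSq (μ : Vec p) {v : ℝ} (hv : 0 < v) :
    ∫ x, normalDensity μ v x * ‖x - μ‖ ^ 2 = p * v := by
  have key : ∀ i : Fin p, (Integrable fun x : Vec p => normalDensity μ v x * (x i - μ i) ^ 2) ∧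
      ∫ x, normalDensity μ v x * (x i - μ i) ^ 2 = v := by
    intro i
    have hb : ∀ x : Vec p, |x i - μ i| ≤ ‖x - μ‖ := fun x => abs_apply_le_norm (x - μ) i
    have h1 : Integrable fun x : Vec p => normalDensity μ v x * (x i - μ i) ^ 2 := by
      refine integrable_normalDensity_mul μ hv (by fun_prop) (A := 0) (B := 1) fun x => ?_
      rw [abs_pow]
      have := hb x
      have := abs_nonneg (x i - μ i)
      nlinarith
    have := integral_normalDensity_mul_sub μ hv i (f := fun x => x i - μ i)
      (f' := fun _ => EuclideanSpace.proj i)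
      (fun x => ((EuclideanSpace.proj i : Vec p →L[ℝ] ℝ).hasFDerivAt).sub_const _)
      (integrable_normalDensity_mul μ hv (by fun_prop) (A := 1) (B := 1) fun x => by
        have := hb x
        nlinarith [sq_nonneg (‖x - μ‖ - 1)])
      (by simpa [sq] using h1)
      (by simpa using integrable_normalDensity μ hv)
    refine ⟨h1, ?_⟩
    simpa [← sq, integral_normalDensity μ hv] using this
  have e : ∀ x : Vec p, normalDensity μ v x * ‖x - μ‖ ^ 2
      = ∑ i, normalDensity μ v x * (x i - μ i) ^ 2 := by
    intro x
    rw [EuclideanSpace.real_norm_sq_eq, Finset.mul_sum]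
    simp
  simp_rw [e]
  rw [integral_finsetSum _ fun i _ => (key i).1]
  simp [fun i => (key i).2]

lemma integrable_normalDensity_smul_sub (μ : Vec p) {v : ℝ} (hv : 0 < v) :
    Integrable fun x => normalDensity μ v x • (x - μ) := by
  have := integrable_normalDensity_mul μ hv (f := fun x => ‖x - μ‖) (by fun_prop)
    (A := 1) (B := 1) fun x => by
      rw [abs_norm]
      nlinarith [sq_nonneg (‖x - μ‖ - 1), norm_nonneg (x - μ)]
  refine this.mono' ((continuous_normalDensity μ v).smul (by fun_prop)).aestronglyMeasurable
    (.of_forall fun x => ?_)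
  rw [norm_smul, Real.norm_of_nonneg (normalDensity_pos μ hv x).le]

/-- The centred integrand is odd, so the integral equals its own negative, whatever `v` is. -/
lemma integral_normalDensity_smul_sub (μ : Vec p) (v : ℝ) :
    ∫ x, normalDensity μ v x • (x - μ) = 0 := by
  simp_rw [normalDensity_eq_sub μ]
  rw [integral_sub_right_eq_self (fun x => normalDensity 0 v x • x) μ]
  have := integral_neg_eq_self (fun x : Vec p => normalDensity 0 v x • x) volume
  simp only [normalDensity_neg, smul_neg, integral_neg] at this
  have h2 : (2 : ℝ) • ∫ x : Vec p, normalDensity 0 v x • x = 0 := by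
    rw [two_smul]
    nth_rw 1 [← this]
    exact neg_add_cancel _
  exact (smul_eq_zero.mp h2).resolve_left two_ne_zero

lemma integrable_normalDensity_smul (μ : Vec p) {v : ℝ} (hv : 0 < v) :
    Integrable fun x => normalDensity μ v x • x := by
  refine ((integrable_normalDensity_smul_sub μ hv).add
    ((integrable_normalDensity μ hv).smul_const μ)).congr (.of_forall fun x => ?_)
  simp only [Pi.add_apply]
  rw [← smul_add, sub_add_cancel]

lemma integral_normalDensity_smul (μ : Vec p) {v : ℝ} (hv : 0 < v) :
    ∫ x, normalDensity μ v x • x = μ := by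
  have e : ∀ x : Vec p, normalDensity μ v x • x
      = normalDensity μ v x • (x - μ) + normalDensity μ v x • μ := by
    intro x; rw [← smul_add, sub_add_cancel]
  simp_rw [e]
  rw [integral_add (integrable_normalDensity_smul_sub μ hv)
    ((integrable_normalDensity μ hv).smul_const μ), integral_normalDensity_smul_sub,
    integral_smul_const, integral_normalDensity μ hv]
  simp

/-- Completing the square: the joint normal density factors as marginal times conditional. -/
lemma normalDensity_mul_normalDensity {τ : ℝ} (hτ : 0 < τ) (y β : Vec p) :
    normalDensity β 1 y * normalDensity 0 τ β
      = normalDensity 0 (1 + τ) y * normalDensity ((τ / (1 + τ)) • y) (τ / (1 + τ)) β := by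
  unfold normalDensity
  have h1 : (0 : ℝ) < 1 + τ := by positivity
  have hc : (2 * Real.pi * 1) ^ (-(p : ℝ) / 2) * (2 * Real.pi * τ) ^ (-(p : ℝ) / 2)
      = (2 * Real.pi * (1 + τ)) ^ (-(p : ℝ) / 2)
        * (2 * Real.pi * (τ / (1 + τ))) ^ (-(p : ℝ) / 2) := by
    rw [← Real.mul_rpow (by positivity) (by positivity),
      ← Real.mul_rpow (by positivity) (by positivity)]
    congr 1
    field_simp
  have he : -‖y - β‖ ^ 2 / (2 * 1) + -‖β - 0‖ ^ 2 / (2 * τ)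
      = -‖y - 0‖ ^ 2 / (2 * (1 + τ)) + -‖β - (τ / (1 + τ)) • y‖ ^ 2 / (2 * (τ / (1 + τ))) := by
    rw [norm_sub_sq_real, norm_sub_sq_real β ((τ / (1 + τ)) • y), norm_smul, mul_pow,
      Real.norm_eq_abs, sq_abs, real_inner_smul_right, real_inner_comm β y]
    simp only [sub_zero]
    field_simp
    ring
  rw [mul_mul_mul_comm, ← Real.exp_add, hc, he, Real.exp_add, mul_mul_mul_comm]

/-- A finite measure is determined by its characteristic function, and both sides have exp(-‖t‖²/2).
This links the abstract Gaussian measure to the explicit density. -/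
lemma stdGaussian_eq_withDensity :
    stdGaussian (Vec p)
      = volume.withDensity fun x => ENNReal.ofReal (normalDensity (0 : Vec p) 1 x) := by
  have hfin : IsFiniteMeasure
      (volume.withDensity fun x => ENNReal.ofReal (normalDensity (0 : Vec p) 1 x)) := by
    refine isFiniteMeasure_withDensity ?_
    rw [lintegral_normalDensity _ one_pos]
    exact ENNReal.one_ne_top
  refine Measure.ext_of_charFun (funext fun t => ?_)
  rw [charFun_stdGaussian, charFun_apply, integral_withDensity_eq_integral_toReal_smul
    (by fun_prop) (.of_forall fun _ => ENNReal.ofReal_lt_top)]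
  have h := GaussianFourier.integral_cexp_neg_mul_sq_norm_add (V := Vec p) (b := 1 / 2)
    (by norm_num) Complex.I t
  have e : ∀ x : Vec p, (ENNReal.ofReal (normalDensity 0 1 x)).toReal
      • Complex.exp (inner ℝ x t * Complex.I)
      = ((2 * Real.pi : ℝ) ^ (-(p : ℝ) / 2) : ℝ)
        * Complex.exp (-(1 / 2) * ‖x‖ ^ 2 + Complex.I * inner ℝ t x) := by
    intro x
    rw [ENNReal.toReal_ofReal (normalDensity_pos _ one_pos x).le, Complex.real_smul, normalDensity,
      Complex.ofReal_mul, mul_assoc, Complex.ofReal_exp, ← Complex.exp_add, real_inner_comm]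
    rw [mul_one, sub_zero]
    congr 2
    push_cast
    ring
  simp_rw [e]
  rw [integral_const_mul, h]
  have h2 : ((Real.pi : ℂ) / (1 / 2)) ^ ((Module.finrank ℝ (Vec p) : ℂ) / 2)
      = ((2 * Real.pi : ℝ) ^ ((p : ℝ) / 2) : ℝ) := by
    rw [Complex.ofReal_cpow (by positivity)]
    congr 1
    · push_cast; ring
    · simp
  rw [h2, ← mul_assoc, ← Complex.ofReal_mul, ← Real.rpow_add (by positivity)]
  simp [neg_div]
  ring_nf

lemma normalModel_apply (β : Vec p) :
    normalModel p β = volume.withDensity fun y => ENNReal.ofReal (normalDensity β 1 y) := by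
  change multivariateGaussian β 1 = _
  have h : multivariateGaussian β (1 : Matrix (Fin p) (Fin p) ℝ)
      = (stdGaussian (Vec p)).map (fun x => β + x) := by
    simp [multivariateGaussian]
  rw [h, stdGaussian_eq_withDensity]
  ext s hs
  rw [Measure.map_apply (by fun_prop) hs, withDensity_apply _ hs,
    withDensity_apply _ (hs.preimage (by fun_prop)), ← lintegral_indicator hs,
    ← lintegral_indicator (hs.preimage (by fun_prop)),
    ← lintegral_add_left_eq_self (μ := volume) (s.indicator _) β]
  congr 1 with x
  by_cases hx : β + x ∈ s
  · rw [Set.indicator_of_mem hx, Set.indicator_of_mem (by exact hx), normalDensity_eq_sub β]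
    simp
  · rw [Set.indicator_of_notMem hx, Set.indicator_of_notMem (by exact hx)]

/-! ### The minimax risk of the normal location model -/

@[fun_prop]
lemma measurable_quadLoss {α : Type*} [MeasurableSpace α] {f g : α → Vec p}
    (hf : Measurable f) (hg : Measurable g) : Measurable fun a => quadLoss (f a) (g a) := by
  unfold quadLoss
  fun_prop

/-- Bias-variance decomposition: the expected loss of the decision `d` is pv + ‖d - μ‖², because the
cross term is centred. -/
lemma ofReal_le_lintegral_normalDensity_mul_quadLoss (μ : Vec p) {v : ℝ} (hv : 0 < v)
    (d : Vec p) :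
    ENNReal.ofReal (p * v) ≤ ∫⁻ β, ENNReal.ofReal (normalDensity μ v β) * quadLoss β d := by
  have e : ∀ β : Vec p, normalDensity μ v β * ‖d - β‖ ^ 2
      = normalDensity μ v β * ‖β - μ‖ ^ 2
        - 2 * inner ℝ (d - μ) (normalDensity μ v β • (β - μ))
        + normalDensity μ v β * ‖d - μ‖ ^ 2 := by
    intro β
    rw [show d - β = (d - μ) - (β - μ) by abel, norm_sub_sq_real, real_inner_smul_right]
    ring
  have i1 := integrable_normalDensity_mul_normSq μ hv
  have i2 : Integrable fun β => 2 * inner ℝ (d - μ) (normalDensity μ v β • (β - μ)) :=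
    ((integrable_normalDensity_smul_sub μ hv).const_inner (d - μ)).const_mul 2
  have i3 := (integrable_normalDensity μ hv).mul_const (‖d - μ‖ ^ 2)
  have hint : Integrable fun β : Vec p => normalDensity μ v β * ‖d - β‖ ^ 2 := by
    simp_rw [e]
    exact (i1.sub i2).add i3
  have hval : ∫ β : Vec p, normalDensity μ v β * ‖d - β‖ ^ 2 = p * v + ‖d - μ‖ ^ 2 := by
    simp_rw [e]
    have i12 : Integrable fun β => normalDensity μ v β * ‖β - μ‖ ^ 2
      - 2 * inner ℝ (d - μ) (normalDensity μ v β • (β - μ)) := i1.sub i2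
    rw [integral_add i12 i3, integral_sub i1 i2, integral_const_mul,
      integral_inner (integrable_normalDensity_smul_sub μ hv), integral_normalDensity_smul_sub,
      integral_normalDensity_mul_normSq μ hv, integral_mul_const, integral_normalDensity μ hv]
    simp
  calc ENNReal.ofReal (p * v) ≤ ENNReal.ofReal (∫ β : Vec p, normalDensity μ v β * ‖d - β‖ ^ 2) :=
        ENNReal.ofReal_le_ofReal (by rw [hval]; nlinarith [sq_nonneg ‖d - μ‖])
    _ = ∫⁻ β : Vec p, ENNReal.ofReal (normalDensity μ v β * ‖d - β‖ ^ 2) :=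
        ofReal_integral_eq_lintegral_ofReal hint
          (.of_forall fun β => mul_nonneg (normalDensity_pos μ hv β).le (by positivity))
    _ = _ := by
        congr 1 with β
        rw [ENNReal.ofReal_mul (normalDensity_pos μ hv β).le, quadLoss]

/-- Tonelli turns the average risk into a posterior expected loss averaged over `y`. The posterior
is normal with variance τ/(1+τ), and the resulting bound holds for every decision `d`, hence for
randomized ones. -/
lemma ofReal_le_bayesRisk_normal {τ : ℝ} (hτ : 0 < τ) :
    ENNReal.ofReal (p * (τ / (1 + τ))) ≤ bayesRisk quadLoss (normalModel p)
      (volume.withDensity fun β => ENNReal.ofReal (normalDensity (0 : Vec p) τ β)) := by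
  refine le_iInf fun κ => le_iInf fun hκ => ?_
  have hL : Measurable fun q : Vec p × Vec p => ∫⁻ d, quadLoss q.1 d ∂(κ q.2) := by
    have : Measurable fun q : (Vec p × Vec p) × Vec p => quadLoss q.1.1 q.2 :=
      by fun_prop
    have h := Measurable.lintegral_kernel_prod_right'
      (κ := κ.comap (Prod.snd : Vec p × Vec p → Vec p) measurable_snd) this
    simpa only [Kernel.comap_apply] using h
  have hs : 0 < τ / (1 + τ) := by positivity
  have hLy : ∀ β : Vec p, Measurable fun y => ∫⁻ d, quadLoss β d ∂(κ y) := fun β =>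
    hL.comp (measurable_const.prodMk measurable_id)
  calc ENNReal.ofReal (p * (τ / (1 + τ)))
      = ∫⁻ y : Vec p, ENNReal.ofReal (normalDensity 0 (1 + τ) y)
          * ENNReal.ofReal (p * (τ / (1 + τ))) := by
        rw [lintegral_mul_const _ (by fun_prop), lintegral_normalDensity _ (by positivity), one_mul]
    _ ≤ ∫⁻ y : Vec p, ENNReal.ofReal (normalDensity 0 (1 + τ) y) * ∫⁻ d, (∫⁻ β : Vec p,
          ENNReal.ofReal (normalDensity ((τ / (1 + τ)) • y) (τ / (1 + τ)) β) * quadLoss β d)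
            ∂(κ y) := by
        gcongr with y
        calc _ = ∫⁻ _, ENNReal.ofReal (p * (τ / (1 + τ))) ∂(κ y) := by simp
          _ ≤ _ := lintegral_mono fun d =>
            ofReal_le_lintegral_normalDensity_mul_quadLoss _ hs d
    _ = ∫⁻ y : Vec p, ∫⁻ β : Vec p, ENNReal.ofReal (normalDensity β 1 y * normalDensity 0 τ β)
          * ∫⁻ d, quadLoss β d ∂(κ y) := by
        congr 1 with y
        rw [lintegral_lintegral_swap (by
          refine Measurable.aemeasurable ?_
          simp only [Function.uncurry_def]
          fun_prop),
          ← lintegral_const_mul _ (by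
          refine Measurable.lintegral_prod_right' (f := fun q : Vec p × Vec p =>
            ENNReal.ofReal (normalDensity ((τ / (1 + τ)) • y) (τ / (1 + τ)) q.1)
              * quadLoss q.1 q.2) ?_
          fun_prop)]
        congr 1 with β
        rw [lintegral_const_mul _ (by fun_prop),
          ← mul_assoc, ← ENNReal.ofReal_mul (normalDensity_pos _ (by positivity) y).le,
          normalDensity_mul_normalDensity hτ]
    _ = ∫⁻ β : Vec p, ∫⁻ y : Vec p, ENNReal.ofReal (normalDensity β 1 y * normalDensity 0 τ β)
          * ∫⁻ d, quadLoss β d ∂(κ y) :=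
        lintegral_lintegral_swap (by
          refine Measurable.aemeasurable (Measurable.mul (by fun_prop) ?_)
          exact hL.comp measurable_swap)
    _ = avgRisk quadLoss (normalModel p) κ
          (volume.withDensity fun β => ENNReal.ofReal (normalDensity (0 : Vec p) τ β)) := by
        unfold avgRisk
        have hc : ∀ β : Vec p, ∫⁻ d, quadLoss β d ∂((κ ∘ₖ normalModel p) β)
            = ∫⁻ y, ENNReal.ofReal (normalDensity β 1 y) * ∫⁻ d, quadLoss β d ∂(κ y) := by
          intro β
          rw [Kernel.lintegral_comp _ _ _
            (by fun_prop), normalModel_apply,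
            lintegral_withDensity_eq_lintegral_mul _ (by fun_prop) (hLy β)]
          rfl
        simp_rw [hc]
        have hm : Measurable fun β : Vec p =>
            ∫⁻ y, ENNReal.ofReal (normalDensity β 1 y) * ∫⁻ d, quadLoss β d ∂(κ y) :=
          Measurable.lintegral_prod_right' (f := fun q : Vec p × Vec p =>
            ENNReal.ofReal (normalDensity q.1 1 q.2) * ∫⁻ d, quadLoss q.1 d ∂(κ q.2))
            (Measurable.mul (by fun_prop) hL)
        rw [lintegral_withDensity_eq_lintegral_mul _ (by fun_prop) hm]
        congr 1 with β
        have hmy : Measurable fun y =>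
            ENNReal.ofReal (normalDensity β 1 y) * ∫⁻ d, quadLoss β d ∂(κ y) :=
          Measurable.mul (by fun_prop) (hLy β)
        rw [Pi.mul_apply, ← lintegral_const_mul _ hmy]
        congr 1 with y
        rw [ENNReal.ofReal_mul (normalDensity_pos _ one_pos y).le]
        ring

/-- The minimax risk of the normal location model is at least the dimension. -/
theorem natCast_le_minimaxRisk (p : ℕ) : (p : ℝ≥0∞) ≤ minimaxRisk quadLoss (normalModel p) := by
  -- The conjugate priors have variance τ = n + 1, so their Bayes risk bounds increase to `p`.
  have hlim : Filter.Tendsto (fun n : ℕ => ENNReal.ofReal (p * (((n : ℝ) + 1) / (1 + (n + 1)))))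
      Filter.atTop (nhds p) := by
    rw [← ENNReal.ofReal_natCast p]
    refine ENNReal.tendsto_ofReal ?_
    have h := (tendsto_natCast_div_add_atTop (1 : ℝ)).comp (Filter.tendsto_add_atTop_nat 1)
    have := h.const_mul (p : ℝ)
    rw [mul_one] at this
    refine this.congr fun n => ?_
    simp [add_comm]
  refine le_of_tendsto hlim (.of_forall fun n => ?_)
  have hτ : (0 : ℝ) < (n : ℝ) + 1 := by positivity
  have : IsProbabilityMeasure
      (volume.withDensity fun β => ENNReal.ofReal (normalDensity (0 : Vec p) ((n : ℝ) + 1) β)) :=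
    ⟨by rw [withDensity_apply _ .univ, setLIntegral_univ, lintegral_normalDensity _ hτ]⟩
  exact (ofReal_le_bayesRisk_normal hτ).trans (bayesRisk_le_minimaxRisk _ _ _)

lemma minimaxRisk_le_iSup_risk {δ : Vec p → Vec p} (hδ : Measurable δ) :
    minimaxRisk quadLoss (normalModel p) ≤ ⨆ β, risk δ β := by
  refine iInf_le_of_le (Kernel.deterministic δ hδ)
    (iInf_le_of_le inferInstance (iSup_mono fun β => ?_))
  have hm : Measurable fun d : Vec p => quadLoss β d := by
    fun_prop
  rw [Kernel.lintegral_comp _ _ _ hm, risk]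
  simp_rw [Kernel.lintegral_deterministic' hδ hm]
  exact le_rfl

lemma isMinimax_of_risk_le {δ : Vec p → Vec p} (hδ : Measurable δ) (h : ∀ β, risk δ β ≤ p) :
    IsMinimax δ :=
  ⟨hδ, ((iSup_le h).trans (natCast_le_minimaxRisk p)).antisymm (minimaxRisk_le_iSup_risk hδ)⟩

/-! ### Stein's unbiased risk estimate for shrinkage estimators -/

lemma normSq_le_two_mul (x μ : Vec p) : ‖x‖ ^ 2 ≤ 2 * ‖μ‖ ^ 2 + 2 * ‖x - μ‖ ^ 2 := by
  have h : ‖x‖ ≤ ‖μ‖ + ‖x - μ‖ := by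
    simpa using norm_add_le μ (x - μ)
  nlinarith [norm_nonneg x, sq_nonneg (‖μ‖ - ‖x - μ‖)]

/-- A spherically symmetric shrinkage estimator whose unbiased risk estimate does not exceed the
dimension has risk at most the dimension. -/
theorem risk_shrinkage_le {φ φ' : ℝ → ℝ} (hφ : ∀ r, HasDerivAt φ (φ' r) r)
    (h1 : ∀ r, |φ r| ≤ 1) (h1' : ∀ r, |φ' r| ≤ 1)
    (hsure : ∀ r, 0 ≤ r → r * φ r ^ 2 ≤ 2 * (p * φ r + 2 * r * φ' r)) (β : Vec p) :
    risk (fun y => (1 - φ (‖y‖ ^ 2)) • y) β ≤ p := by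
  have hc : Continuous φ := continuous_iff_continuousAt.2 fun r => (hφ r).continuousAt
  have hm' : Measurable φ' := by
    rw [show φ' = deriv φ from funext fun r => (hφ r).deriv.symm]
    exact measurable_deriv φ
  let N := normalDensity β 1
  have hN : ∀ y, 0 < N y := normalDensity_pos β one_pos
  have hdir : ∀ (i : Fin p) (y : Vec p), HasFDerivAt (fun y : Vec p => φ (‖y‖ ^ 2) * y i)
      (φ (‖y‖ ^ 2) • (EuclideanSpace.proj i : Vec p →L[ℝ] ℝ)
        + y i • (φ' (‖y‖ ^ 2) • (2 • (innerSL ℝ y : Vec p →L[ℝ] ℝ)))) y := by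
    intro i y
    have hsq : HasFDerivAt (fun y : Vec p => ‖y‖ ^ 2) (2 • (innerSL ℝ y : Vec p →L[ℝ] ℝ)) y := by
      simpa using (hasFDerivAt_id y).norm_sq
    exact ((hφ _).comp_hasFDerivAt y hsq).mul
      ((EuclideanSpace.proj i : Vec p →L[ℝ] ℝ).hasFDerivAt)
  have hval : ∀ (i : Fin p) (y : Vec p), (φ (‖y‖ ^ 2) • (EuclideanSpace.proj i : Vec p →L[ℝ] ℝ)
        + y i • (φ' (‖y‖ ^ 2) • (2 • (innerSL ℝ y : Vec p →L[ℝ] ℝ)))) (EuclideanSpace.single i 1)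
      = φ (‖y‖ ^ 2) + 2 * φ' (‖y‖ ^ 2) * y i ^ 2 := by
    intro i y
    simp [EuclideanSpace.inner_single_right]
    ring
  have hφy : ∀ (i : Fin p) (y : Vec p), |φ (‖y‖ ^ 2) * y i| ≤ ‖y‖ := fun i y => by
    rw [abs_mul]
    exact (mul_le_of_le_one_left (abs_nonneg _) (h1 _)).trans (abs_apply_le_norm y i)
  -- Since φ and φ' are bounded by 1, all integrands below have at most quadratic growth.
  have i0 : ∀ i, Integrable fun y => N y * (φ (‖y‖ ^ 2) * y i) := fun i =>
    integrable_normalDensity_mul β one_pos (by fun_prop) (A := 1 + 2 * ‖β‖ ^ 2) (B := 2) fun y => by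
      have := hφy i y
      nlinarith [normSq_le_two_mul y β, sq_nonneg (‖y‖ - 1)]
  have i1 : ∀ i, Integrable fun y => N y * (φ (‖y‖ ^ 2) * y i * (y i - β i)) := fun i =>
    integrable_normalDensity_mul β one_pos (by fun_prop) (A := 2 * ‖β‖ ^ 2) (B := 3) fun y => by
      rw [abs_mul]
      have h2 : |y i - β i| ≤ ‖y - β‖ := abs_apply_le_norm (y - β) i
      calc _ ≤ ‖y‖ * ‖y - β‖ := mul_le_mul (hφy i y) h2 (abs_nonneg _) (norm_nonneg _)
        _ ≤ _ := by nlinarith [normSq_le_two_mul y β, sq_nonneg (‖y‖ - ‖y - β‖), norm_nonneg y]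
  have i2 : ∀ i, Integrable fun y => N y * (φ (‖y‖ ^ 2) + 2 * φ' (‖y‖ ^ 2) * y i ^ 2) := fun i =>
    integrable_normalDensity_mul β one_pos
      (Measurable.aestronglyMeasurable (by fun_prop))
      (A := 1 + 4 * ‖β‖ ^ 2) (B := 4) fun y => by
      have h3 : y i ^ 2 ≤ ‖y‖ ^ 2 := sq_le_sq.2 (by simpa using abs_apply_le_norm y i)
      calc _ ≤ |φ (‖y‖ ^ 2)| + 2 * |φ' (‖y‖ ^ 2)| * y i ^ 2 := by
            refine (abs_add_le _ _).trans_eq ?_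
            rw [abs_mul, abs_mul, abs_two, abs_pow, sq_abs]
        _ ≤ 1 + 2 * 1 * ‖y‖ ^ 2 := by
            gcongr
            · exact h1 _
            · exact h1' _
        _ ≤ _ := by nlinarith [normSq_le_two_mul y β]
  have i3 : Integrable fun y => N y * (‖y‖ ^ 2 * φ (‖y‖ ^ 2) ^ 2) :=
    integrable_normalDensity_mul β one_pos (by fun_prop) (A := 2 * ‖β‖ ^ 2) (B := 2) fun y => by
      rw [abs_mul, abs_pow, abs_pow, abs_norm]
      refine le_trans ?_ (normSq_le_two_mul y β)
      exact mul_le_of_le_one_right (by positivity) (pow_le_one₀ (abs_nonneg _) (h1 _))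
  have i4 : Integrable fun y => N y * ‖y - β‖ ^ 2 := integrable_normalDensity_mul_normSq β one_pos
  have stein : ∀ i, ∫ y, N y * (φ (‖y‖ ^ 2) * y i * (y i - β i))
      = ∫ y, N y * (φ (‖y‖ ^ 2) + 2 * φ' (‖y‖ ^ 2) * y i ^ 2) := fun i => by
    have := integral_normalDensity_mul_sub β one_pos i (hdir i) (i0 i) (i1 i)
      (by simpa only [hval] using i2 i)
    simpa only [hval, one_mul] using this
  have s1 : Integrable fun y => ∑ i, N y * (φ (‖y‖ ^ 2) * y i * (y i - β i)) :=
    integrable_finsetSum _ fun i _ => i1 i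
  have s2 : Integrable fun y => ∑ i, N y * (φ (‖y‖ ^ 2) + 2 * φ' (‖y‖ ^ 2) * y i ^ 2) :=
    integrable_finsetSum _ fun i _ => i2 i
  -- Expanding the loss leaves a cross term φ⟨y - β, y⟩; Stein's identity replaces its integral by
  -- that of the divergence pφ + 2rφ'.
  have e : ∀ y : Vec p, N y * ‖(1 - φ (‖y‖ ^ 2)) • y - β‖ ^ 2
      = N y * ‖y - β‖ ^ 2 + N y * (‖y‖ ^ 2 * φ (‖y‖ ^ 2) ^ 2)
        - 2 * ∑ i, N y * (φ (‖y‖ ^ 2) * y i * (y i - β i)) := by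
    intro y
    have hs : ∑ i, N y * (φ (‖y‖ ^ 2) * y i * (y i - β i))
        = N y * (φ (‖y‖ ^ 2) * inner ℝ (y - β) y) := by
      rw [PiLp.inner_apply, Finset.mul_sum, Finset.mul_sum]
      refine Finset.sum_congr rfl fun i _ => ?_
      simp only [RCLike.inner_apply, conj_trivial, PiLp.sub_apply]
      ring
    rw [hs, show (1 - φ (‖y‖ ^ 2)) • y - β = (y - β) - φ (‖y‖ ^ 2) • y by
        rw [sub_smul, one_smul]; abel, norm_sub_sq_real, norm_smul, mul_pow, real_inner_smul_right, Real.norm_eq_abs, sq_abs]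
    ring
  have hint : Integrable fun y => N y * ‖(1 - φ (‖y‖ ^ 2)) • y - β‖ ^ 2 := by
    simp_rw [e]
    exact (i4.add i3).sub (s1.const_mul 2)
  have hle : ∫ y, N y * ‖(1 - φ (‖y‖ ^ 2)) • y - β‖ ^ 2 ≤ p := by
    simp_rw [e]
    have i43 : Integrable fun y => N y * ‖y - β‖ ^ 2 + N y * (‖y‖ ^ 2 * φ (‖y‖ ^ 2) ^ 2) :=
      i4.add i3
    rw [integral_sub i43 (s1.const_mul 2), integral_add i4 i3, integral_const_mul,
      integral_finsetSum _ fun i _ => i1 i, Finset.sum_congr rfl fun i _ => stein i,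
      ← integral_finsetSum _ fun i _ => i2 i]
    -- The hypothesis `hsure` enters here, pointwise with r = ‖y‖²: the excess over `p` is
    -- nonpositive.
    have h5 : ∫ y, N y * (‖y‖ ^ 2 * φ (‖y‖ ^ 2) ^ 2)
        ≤ ∫ y, 2 * ∑ i, N y * (φ (‖y‖ ^ 2) + 2 * φ' (‖y‖ ^ 2) * y i ^ 2) := by
      refine integral_mono i3 (s2.const_mul 2) fun y => ?_
      have hs : ∑ i, N y * (φ (‖y‖ ^ 2) + 2 * φ' (‖y‖ ^ 2) * y i ^ 2)
          = N y * (p * φ (‖y‖ ^ 2) + 2 * ‖y‖ ^ 2 * φ' (‖y‖ ^ 2)) := by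
        rw [← Finset.mul_sum, Finset.sum_add_distrib, ← Finset.mul_sum,
          ← EuclideanSpace.real_norm_sq_eq]
        simp
        ring_nf
        simp
      change N y * _ ≤ 2 * ∑ i, _
      rw [hs]
      have := mul_le_mul_of_nonneg_left (hsure (‖y‖ ^ 2) (by positivity)) (hN y).le
      linarith
    rw [integral_const_mul] at h5
    have h6 : ∫ y, N y * ‖y - β‖ ^ 2 = p := by
      simpa using integral_normalDensity_mul_normSq β one_pos
    linarith
  rw [risk, normalModel_apply, lintegral_withDensity_eq_lintegral_mul _ (by fun_prop)
    (by unfold quadLoss; fun_prop)]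
  calc _ = ∫⁻ y, ENNReal.ofReal (N y * ‖(1 - φ (‖y‖ ^ 2)) • y - β‖ ^ 2) := by
        congr 1 with y
        rw [Pi.mul_apply, ENNReal.ofReal_mul (hN y).le, quadLoss]
    _ = ENNReal.ofReal (∫ y, N y * ‖(1 - φ (‖y‖ ^ 2)) • y - β‖ ^ 2) :=
        (ofReal_integral_eq_lintegral_ofReal hint
          (.of_forall fun y => mul_nonneg (hN y).le (by positivity))).symm
    _ ≤ ENNReal.ofReal p := ENNReal.ofReal_le_ofReal hle
    _ = p := ENNReal.ofReal_natCast p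

/-! ### Moments of exponentially tilted weights on the unit interval -/

/-- The `j`-th moment of the weight `w` on `(0, 1)` tilted by `exp (-κ r / 2)`. -/
noncomputable def tiltedMoment (w : ℝ → ℝ) (j : ℕ) (r : ℝ) : ℝ :=
  ∫ κ in Set.Ioo 0 1, κ ^ j * (w κ * Real.exp (-(κ * r / 2)))

variable {w : ℝ → ℝ}

lemma integrableOn_tilted (hw : IntegrableOn w (Set.Ioo 0 1)) (j : ℕ) (r : ℝ) :
    IntegrableOn (fun κ => κ ^ j * (w κ * Real.exp (-(κ * r / 2)))) (Set.Ioo 0 1) := by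
  have : IntegrableOn (fun κ => w κ * (κ ^ j * Real.exp (-(κ * r / 2)))) (Set.Ioo 0 1) := by
    refine Integrable.mul_bdd (c := Real.exp (|r| / 2)) hw (by fun_prop) ?_
    filter_upwards [ae_restrict_mem measurableSet_Ioo] with κ hκ
    rw [norm_mul, norm_pow, Real.norm_of_nonneg hκ.1.le, Real.norm_of_nonneg (Real.exp_pos _).le]
    refine (mul_le_of_le_one_left (Real.exp_pos _).le (pow_le_one₀ hκ.1.le hκ.2.le)).trans ?_
    rw [Real.exp_le_exp]
    nlinarith [neg_abs_le r, abs_nonneg r, hκ.1, hκ.2]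
  exact this.congr (.of_forall fun κ => by ring)

lemma tiltedMoment_pos (hw : IntegrableOn w (Set.Ioo 0 1)) (hpos : ∀ κ ∈ Set.Ioo (0 : ℝ) 1, 0 < w κ)
    (j : ℕ) (r : ℝ) : 0 < tiltedMoment w j r := by
  have h : ∀ κ ∈ Set.Ioo (0 : ℝ) 1, 0 < κ ^ j * (w κ * Real.exp (-(κ * r / 2))) := fun κ hκ =>
    mul_pos (pow_pos hκ.1 j) (mul_pos (hpos κ hκ) (Real.exp_pos _))
  refine (setIntegral_pos_iff_support_of_nonneg_ae ?_ (integrableOn_tilted hw j r)).2 ?_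
  · filter_upwards [ae_restrict_mem measurableSet_Ioo] with κ hκ using (h κ hκ).le
  · refine lt_of_lt_of_le ?_ (measure_mono (s := Set.Ioo (0 : ℝ) 1)
      fun κ hκ => ⟨(h κ hκ).ne', hκ⟩)
    simp

lemma tiltedMoment_succ_le (hw : IntegrableOn w (Set.Ioo 0 1))
    (hpos : ∀ κ ∈ Set.Ioo (0 : ℝ) 1, 0 < w κ) (j : ℕ) (r : ℝ) :
    tiltedMoment w (j + 1) r ≤ tiltedMoment w j r := by
  refine setIntegral_mono_on (integrableOn_tilted hw _ r) (integrableOn_tilted hw j r)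
    measurableSet_Ioo fun κ hκ => ?_
  have := mul_pos (hpos κ hκ) (Real.exp_pos (-(κ * r / 2)))
  exact mul_le_mul_of_nonneg_right (pow_le_pow_of_le_one hκ.1.le hκ.2.le j.le_succ) this.le

/-- Differentiation under the integral sign, dominated on the unit ball around `r`. Negative `r` is
included because the shrinkage function has to be differentiable on the whole line. -/
lemma hasDerivAt_tiltedMoment (hw : IntegrableOn w (Set.Ioo 0 1)) (j : ℕ) (r : ℝ) :
    HasDerivAt (tiltedMoment w j) (-(1 / 2) * tiltedMoment w (j + 1) r) r := by
  have hm : AEStronglyMeasurable w (volume.restrict (Set.Ioo 0 1)) := hw.aestronglyMeasurable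
  have := hasDerivAt_integral_of_dominated_loc_of_deriv_le
    (μ := volume.restrict (Set.Ioo (0 : ℝ) 1)) (x₀ := r) (s := Metric.ball r 1)
    (F := fun r κ => κ ^ j * (w κ * Real.exp (-(κ * r / 2))))
    (F' := fun r κ => -(1 / 2) * (κ ^ (j + 1) * (w κ * Real.exp (-(κ * r / 2)))))
    (bound := fun κ => |w κ| * Real.exp ((|r| + 1) / 2))
    (Metric.ball_mem_nhds r one_pos)
    (.of_forall fun s => (integrableOn_tilted hw j s).aestronglyMeasurable)
    (integrableOn_tilted hw j r)
    ((integrableOn_tilted hw (j + 1) r).aestronglyMeasurable.const_mul _)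
    (by
      filter_upwards [ae_restrict_mem measurableSet_Ioo] with κ hκ s hs
      have hs' : |s| ≤ |r| + 1 := by
        rw [Metric.mem_ball, Real.dist_eq] at hs
        have := abs_add_le r (s - r)
        rw [add_sub_cancel] at this
        linarith
      rw [norm_mul, norm_mul, norm_mul, norm_pow, Real.norm_of_nonneg hκ.1.le,
        Real.norm_of_nonneg (Real.exp_pos _).le, Real.norm_eq_abs, Real.norm_eq_abs]
      have e1 : Real.exp (-(κ * s / 2)) ≤ Real.exp ((|r| + 1) / 2) := by
        rw [Real.exp_le_exp]
        nlinarith [neg_abs_le s, abs_nonneg s, hκ.1, hκ.2]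
      have e2 : κ ^ (j + 1) ≤ 1 := pow_le_one₀ hκ.1.le hκ.2.le
      have e3 : |(-(1 / 2) : ℝ)| ≤ 1 := by norm_num [abs_of_neg]
      calc _ ≤ 1 * (1 * (|w κ| * Real.exp ((|r| + 1) / 2))) := by
            have := hκ.1.le
            gcongr
        _ = _ := by ring)
    (hw.norm.mul_const _)
    (.of_forall fun κ s _ => by
      have h1 : HasDerivAt (fun s : ℝ => -(κ * s / 2)) (-(κ * 1 / 2)) s :=
        (((hasDerivAt_id s).const_mul κ).div_const 2).neg
      refine ((h1.exp.const_mul (w κ)).const_mul (κ ^ j)).congr_deriv ?_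
      ring)
  have h2 := this.2
  rw [integral_const_mul] at h2
  exact h2

/-- The posterior mean of the shrinkage coefficient, as a function of `‖y‖²`. -/
noncomputable def shrinkage (w : ℝ → ℝ) (r : ℝ) : ℝ := tiltedMoment w 1 r / tiltedMoment w 0 r

lemma continuous_shrinkage (hw : IntegrableOn w (Set.Ioo 0 1))
    (hpos : ∀ κ ∈ Set.Ioo (0 : ℝ) 1, 0 < w κ) : Continuous (shrinkage w) := by
  have h : ∀ j, Continuous (tiltedMoment w j) := fun j =>
    continuous_iff_continuousAt.2 fun r => (hasDerivAt_tiltedMoment hw j r).continuousAt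
  exact (h 1).div (h 0) fun r => (tiltedMoment_pos hw hpos 0 r).ne'

/-- By the quotient rule φ' = -(M₂M₀ - M₁²)/(2M₀²), and clearing M₀² turns the condition of
`risk_shrinkage_le` into `h`. The bounds on φ and φ' follow from M₂ ≤ M₁ ≤ M₀. -/
theorem risk_shrinkage_tilted_le (hw : IntegrableOn w (Set.Ioo 0 1))
    (hpos : ∀ κ ∈ Set.Ioo (0 : ℝ) 1, 0 < w κ)
    (h : ∀ r, 0 ≤ r → 2 * r * (tiltedMoment w 2 r * tiltedMoment w 0 r)
      - r * tiltedMoment w 1 r ^ 2 ≤ 2 * p * (tiltedMoment w 1 r * tiltedMoment w 0 r))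
    (β : Vec p) : risk (fun y => (1 - shrinkage w (‖y‖ ^ 2)) • y) β ≤ p := by
  have hp := tiltedMoment_pos hw hpos
  have hl := tiltedMoment_succ_le hw hpos
  refine risk_shrinkage_le (φ' := fun r => -(1 / 2) * (tiltedMoment w 2 r * tiltedMoment w 0 r
      - tiltedMoment w 1 r ^ 2) / tiltedMoment w 0 r ^ 2) (fun r => ?_) (fun r => ?_) (fun r => ?_)
    (fun r hr => ?_) β
  · refine ((hasDerivAt_tiltedMoment hw 1 r).div (hasDerivAt_tiltedMoment hw 0 r)
      (hp 0 r).ne').congr_deriv ?_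
    ring
  · rw [shrinkage, abs_of_pos (div_pos (hp 1 r) (hp 0 r))]
    exact div_le_one_of_le₀ (hl 0 r) (hp 0 r).le
  · rw [abs_div, abs_of_pos (pow_pos (hp 0 r) 2)]
    refine div_le_one_of_le₀ ?_ (sq_nonneg _)
    have a0 := hp 0 r
    have a1 := hp 1 r
    have a2 := hp 2 r
    have b0 := hl 0 r
    have b1 := hl 1 r
    norm_num at b0 b1
    rw [abs_le]
    constructor <;> nlinarith [mul_pos a2 a0, mul_le_mul b0 b0 a1.le a0.le]
  · have a0 := hp 0 r
    have := h r hr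
    simp only [shrinkage]
    field_simp
    linarith

/-! ### The posterior mean for scale mixtures of normal priors -/

/-- The weight of the mixing variable in the marginal density of the data. -/
noncomputable def mixingWeight (p : ℕ) (prior : ℝ → ℝ) (κ : ℝ) : ℝ :=
  κ ^ ((p : ℝ) / 2) * prior κ

/-- The joint density of the data, the parameter and the mixing variable. -/
noncomputable def jointDensity (prior : ℝ → ℝ) (y : Vec p) (q : ℝ × Vec p) : ℝ :=
  normalDensity q.2 1 y * (normalDensity 0 (q.1⁻¹ * (1 - q.1)) q.2 * prior q.1)

/-- The joint density of the data and the mixing variable. -/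
noncomputable def mixingDensity (prior : ℝ → ℝ) (y : Vec p) (κ : ℝ) : ℝ :=
  (2 * Real.pi) ^ (-(p : ℝ) / 2) * (mixingWeight p prior κ * Real.exp (-(κ * ‖y‖ ^ 2 / 2)))

/-- For τ = κ⁻¹(1 - κ) one has 1 + τ = κ⁻¹ and τ/(1+τ) = 1 - κ, so completing the square makes κ the
shrinkage factor itself. -/
lemma jointDensity_eq (prior : ℝ → ℝ) (y β : Vec p) {κ : ℝ} (hκ : κ ∈ Set.Ioo (0 : ℝ) 1) :
    jointDensity prior y (κ, β)
      = mixingDensity prior y κ * normalDensity ((1 - κ) • y) (1 - κ) β := by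
  have h0 := hκ.1
  have h1 : 0 < 1 - κ := sub_pos.2 hκ.2
  have e1 : 1 + κ⁻¹ * (1 - κ) = κ⁻¹ := by field_simp; ring
  have e2 : κ⁻¹ * (1 - κ) / κ⁻¹ = 1 - κ := by field_simp
  have e3 : normalDensity 0 κ⁻¹ y
      = (2 * Real.pi) ^ (-(p : ℝ) / 2) * (κ ^ ((p : ℝ) / 2) * Real.exp (-(κ * ‖y‖ ^ 2 / 2))) := by
    have e4 : κ⁻¹ ^ (-(p : ℝ) / 2) = κ ^ ((p : ℝ) / 2) := by
      rw [Real.inv_rpow h0.le, ← Real.rpow_neg h0.le, neg_div, neg_neg]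
    have e5 : -‖y‖ ^ 2 / (2 * κ⁻¹) = -(κ * ‖y‖ ^ 2 / 2) := by field_simp
    rw [normalDensity, Real.mul_rpow (by positivity) (by positivity), e4, sub_zero, e5, mul_assoc]
  rw [jointDensity, ← mul_assoc, normalDensity_mul_normalDensity (by positivity), e1, e2, e3,
    mixingDensity, mixingWeight]
  ring

variable {prior : ℝ → ℝ}

lemma measurable_jointDensity (hm : Measurable prior) (y : Vec p) :
    Measurable (jointDensity prior y) := by
  unfold jointDensity
  fun_prop

lemma mixingDensity_pos (hpos : ∀ κ ∈ Set.Ioo (0 : ℝ) 1, 0 < mixingWeight p prior κ) (y : Vec p)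
    {κ : ℝ} (hκ : κ ∈ Set.Ioo (0 : ℝ) 1) : 0 < mixingDensity prior y κ := by
  have := hpos κ hκ
  unfold mixingDensity
  positivity

lemma jointDensity_pos (hpos : ∀ κ ∈ Set.Ioo (0 : ℝ) 1, 0 < mixingWeight p prior κ) (y β : Vec p)
    {κ : ℝ} (hκ : κ ∈ Set.Ioo (0 : ℝ) 1) : 0 < jointDensity prior y (κ, β) := by
  rw [jointDensity_eq prior y β hκ]
  exact mul_pos (mixingDensity_pos hpos y hκ) (normalDensity_pos _ (sub_pos.2 hκ.2) _)

lemma ofReal_normalDensity_mul_betaPrior (hm : Measurable prior) (y β : Vec p) :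
    ENNReal.ofReal (normalDensity β 1 y) * betaPrior p prior β
      = ∫⁻ κ in Set.Ioo 0 1, ENNReal.ofReal (jointDensity prior y (κ, β)) := by
  rw [betaPrior, ← lintegral_const_mul _ (by fun_prop)]
  congr 1 with κ
  rw [jointDensity, ENNReal.ofReal_mul (normalDensity_pos _ one_pos _).le]

lemma integrableOn_mixingDensity (hw : IntegrableOn (mixingWeight p prior) (Set.Ioo 0 1))
    (y : Vec p) : IntegrableOn (mixingDensity prior y) (Set.Ioo 0 1) := by
  have := (integrableOn_tilted hw 0 (‖y‖ ^ 2)).const_mul ((2 * Real.pi) ^ (-(p : ℝ) / 2))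
  simp only [pow_zero, one_mul] at this
  exact this

lemma integral_mixingDensity (y : Vec p) : ∫ κ in Set.Ioo 0 1, mixingDensity prior y κ
    = (2 * Real.pi) ^ (-(p : ℝ) / 2) * tiltedMoment (mixingWeight p prior) 0 (‖y‖ ^ 2) := by
  simp [mixingDensity, tiltedMoment, integral_const_mul]

lemma marginal_betaPrior (hm : Measurable prior)
    (hw : IntegrableOn (mixingWeight p prior) (Set.Ioo 0 1))
    (hpos : ∀ κ ∈ Set.Ioo (0 : ℝ) 1, 0 < mixingWeight p prior κ) (y : Vec p) :
    marginal (betaPrior p prior) y = ENNReal.ofReal ((2 * Real.pi) ^ (-(p : ℝ) / 2)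
      * tiltedMoment (mixingWeight p prior) 0 (‖y‖ ^ 2)) := by
  rw [marginal]
  simp_rw [ofReal_normalDensity_mul_betaPrior hm]
  rw [lintegral_lintegral_swap (((measurable_jointDensity hm y).comp
    measurable_swap).ennreal_ofReal.aemeasurable), ← integral_mixingDensity,
    ofReal_integral_eq_lintegral_ofReal (integrableOn_mixingDensity hw y)
      (by filter_upwards [ae_restrict_mem measurableSet_Ioo] with κ hκ using
        (mixingDensity_pos hpos y hκ).le)]
  refine setLIntegral_congr_fun measurableSet_Ioo fun κ hκ => ?_
  simp_rw [jointDensity_eq prior y _ hκ, ENNReal.ofReal_mul (mixingDensity_pos hpos y hκ).le]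
  rw [lintegral_const_mul _ (by fun_prop), lintegral_normalDensity _ (sub_pos.2 hκ.2), mul_one]

lemma integral_normalDensity_mul_norm_le (μ : Vec p) {v : ℝ} (hv : 0 < v) :
    ∫ x, normalDensity μ v x * ‖x‖ ≤ 1 + ‖μ‖ ^ 2 + p * v := by
  have i1 := integrable_normalDensity_mul_normSq μ hv
  have i0 := (integrable_normalDensity μ hv).const_mul (1 + ‖μ‖ ^ 2)
  calc ∫ x, normalDensity μ v x * ‖x‖
      ≤ ∫ x, ((1 + ‖μ‖ ^ 2) * normalDensity μ v x + normalDensity μ v x * ‖x - μ‖ ^ 2) := by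
        refine integral_mono_of_nonneg (.of_forall fun x =>
          mul_nonneg (normalDensity_pos μ hv x).le (norm_nonneg x)) (i0.add i1)
          (.of_forall fun x => ?_)
        have h : ‖x‖ ≤ 1 + ‖μ‖ ^ 2 + ‖x - μ‖ ^ 2 := by
          nlinarith [normSq_le_two_mul x μ, sq_nonneg (‖x‖ - 1)]
        have := mul_le_mul_of_nonneg_left h (normalDensity_pos μ hv x).le
        simp only
        linarith
    _ = _ := by
        rw [integral_add i0 i1, integral_const_mul, integral_normalDensity μ hv,
          integral_normalDensity_mul_normSq μ hv, mul_one]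

/-- This licenses Fubini for the posterior mean: given κ, the expected norm of β is at most 1 + ‖y‖²
+ p, uniformly in κ. -/
lemma integrable_jointDensity_smul (hm : Measurable prior)
    (hw : IntegrableOn (mixingWeight p prior) (Set.Ioo 0 1))
    (hpos : ∀ κ ∈ Set.Ioo (0 : ℝ) 1, 0 < mixingWeight p prior κ) (y : Vec p) :
    Integrable (fun q : ℝ × Vec p => jointDensity prior y q • q.2)
      ((volume.restrict (Set.Ioo 0 1)).prod volume) := by
  have hmeas : AEStronglyMeasurable (fun q : ℝ × Vec p => jointDensity prior y q • q.2)
      ((volume.restrict (Set.Ioo 0 1)).prod volume) := by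
    have := measurable_jointDensity hm y
    exact Measurable.aestronglyMeasurable (by fun_prop)
  refine (integrable_prod_iff hmeas).2 ⟨?_, ?_⟩
  · filter_upwards [ae_restrict_mem measurableSet_Ioo] with κ hκ
    simp_rw [jointDensity_eq prior y _ hκ, mul_smul]
    exact (integrable_normalDensity_smul ((1 - κ) • y) (sub_pos.2 hκ.2)).smul
      (mixingDensity prior y κ)
  · refine ((integrableOn_mixingDensity hw y).mul_const (1 + ‖y‖ ^ 2 + p)).mono'
      hmeas.norm.integral_prod_right' ?_
    filter_upwards [ae_restrict_mem measurableSet_Ioo] with κ hκ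
    have h1 : 0 < 1 - κ := sub_pos.2 hκ.2
    have hg := mixingDensity_pos hpos y hκ
    have e : ∀ β, ‖jointDensity prior y (κ, β) • β‖ = mixingDensity prior y κ
        * (normalDensity ((1 - κ) • y) (1 - κ) β * ‖β‖) := fun β => by
      rw [norm_smul, Real.norm_of_nonneg (jointDensity_pos hpos y β hκ).le,
        jointDensity_eq prior y β hκ, mul_assoc]
    simp_rw [e]
    rw [integral_const_mul, Real.norm_of_nonneg]
    · refine mul_le_mul_of_nonneg_left
        ((integral_normalDensity_mul_norm_le _ h1).trans ?_) hg.le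
      rw [norm_smul, mul_pow, Real.norm_of_nonneg h1.le]
      have h2 : (1 - κ) ^ 2 ≤ 1 := pow_le_one₀ h1.le (by linarith [hκ.1])
      have h3 : (p : ℝ) * (1 - κ) ≤ p := mul_le_of_le_one_right p.cast_nonneg (by linarith [hκ.1])
      nlinarith [sq_nonneg ‖y‖]
    · exact mul_nonneg hg.le (integral_nonneg fun β =>
        mul_nonneg (normalDensity_pos _ h1 β).le (norm_nonneg β))

lemma integral_jointDensity_smul (hm : Measurable prior)
    (hw : IntegrableOn (mixingWeight p prior) (Set.Ioo 0 1))
    (hpos : ∀ κ ∈ Set.Ioo (0 : ℝ) 1, 0 < mixingWeight p prior κ) (y : Vec p) :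
    ∫ β, (∫ κ in Set.Ioo 0 1, jointDensity prior y (κ, β) • β)
      = ((2 * Real.pi) ^ (-(p : ℝ) / 2) * (tiltedMoment (mixingWeight p prior) 0 (‖y‖ ^ 2)
        - tiltedMoment (mixingWeight p prior) 1 (‖y‖ ^ 2))) • y := by
  rw [← integral_integral_swap (integrable_jointDensity_smul hm hw hpos y)]
  calc _ = ∫ κ in Set.Ioo 0 1, ((2 * Real.pi) ^ (-(p : ℝ) / 2)
        * (κ ^ 0 * (mixingWeight p prior κ * Real.exp (-(κ * ‖y‖ ^ 2 / 2)))
          - κ ^ 1 * (mixingWeight p prior κ * Real.exp (-(κ * ‖y‖ ^ 2 / 2))))) • y := by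
        refine setIntegral_congr_fun measurableSet_Ioo fun κ hκ => ?_
        simp_rw [jointDensity_eq prior y _ hκ, mul_smul]
        rw [integral_smul, integral_normalDensity_smul _ (sub_pos.2 hκ.2), smul_smul,
          mixingDensity, smul_smul]
        congr 1
        ring
    _ = _ := by
        rw [integral_smul_const, integral_const_mul,
          integral_sub (integrableOn_tilted hw 0 _) (integrableOn_tilted hw 1 _)]
        rfl

theorem bayesEstimatorExists_and_eq (hm : Measurable prior)
    (hw : IntegrableOn (mixingWeight p prior) (Set.Ioo 0 1))
    (hpos : ∀ κ ∈ Set.Ioo (0 : ℝ) 1, 0 < mixingWeight p prior κ) :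
    BayesEstimatorExists (betaPrior p prior) ∧ ∀ y, bayesEstimator (betaPrior p prior) y
      = (1 - shrinkage (mixingWeight p prior) (‖y‖ ^ 2)) • y := by
  rw [BayesEstimatorExists, ← forall_and]
  intro y
  have hM := tiltedMoment_pos hw hpos 0 (‖y‖ ^ 2)
  have hc : 0 < (2 * Real.pi) ^ (-(p : ℝ) / 2) := by positivity
  have hmarg := marginal_betaPrior hm hw hpos y
  have h0 : marginal (betaPrior p prior) y ≠ 0 := by
    rw [hmarg]
    exact (ENNReal.ofReal_pos.2 (mul_pos hc hM)).ne'
  have htop : marginal (betaPrior p prior) y ≠ ⊤ := hmarg ▸ ENNReal.ofReal_ne_top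
  have hFm : Measurable fun β => ENNReal.ofReal (normalDensity β 1 y) * betaPrior p prior β := by
    simp_rw [ofReal_normalDensity_mul_betaPrior hm]
    exact ((measurable_jointDensity hm y).ennreal_ofReal).lintegral_prod_left'
  -- The prior density of β may be infinite at exceptional points; finiteness of the marginal
  -- confines them to a null set.
  have hFfin : ∀ᵐ β : Vec p, ENNReal.ofReal (normalDensity β 1 y) * betaPrior p prior β < ⊤ :=
    ae_lt_top hFm htop
  -- The equality holds even where the density is infinite, since `toReal` and the Bochner integral
  -- then both return 0.
  have hF : ∀ β : Vec p,
      (ENNReal.ofReal (normalDensity β 1 y) * betaPrior p prior β).toReal • β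
        = ∫ κ in Set.Ioo 0 1, jointDensity prior y (κ, β) • β := fun β => by
    have hκm : Measurable fun κ => jointDensity prior y (κ, β) :=
      (measurable_jointDensity hm y).comp measurable_prodMk_right
    rw [integral_smul_const, integral_eq_lintegral_of_nonneg_ae
      (by filter_upwards [ae_restrict_mem measurableSet_Ioo] with κ hκ using
        (jointDensity_pos hpos y β hκ).le)
      hκm.aestronglyMeasurable,
      ofReal_normalDensity_mul_betaPrior hm]
  refine ⟨⟨h0, htop, ?_⟩, ?_⟩
  · refine Integrable.smul_measure ?_ (ENNReal.inv_ne_top.2 h0)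
    rw [integrable_withDensity_iff_integrable_smul' hFm hFfin]
    simp_rw [hF]
    exact (integrable_jointDensity_smul hm hw hpos y).integral_prod_right
  · rw [bayesEstimator, posterior, integral_smul_measure,
      integral_withDensity_eq_integral_toReal_smul hFm hFfin]
    simp_rw [hF]
    rw [integral_jointDensity_smul hm hw hpos y, hmarg, ENNReal.toReal_inv,
      ENNReal.toReal_ofReal (mul_pos hc hM).le, smul_smul, shrinkage]
    congr 1
    field_simp

/-- If the posterior moments of the shrinkage coefficient satisfy the pointwise risk inequality,
then the generalized Bayes estimator exists and is minimax. -/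
theorem bayesMinimax_of_tiltedMoment_le (hm : Measurable prior)
    (hw : IntegrableOn (mixingWeight p prior) (Set.Ioo 0 1))
    (hpos : ∀ κ ∈ Set.Ioo (0 : ℝ) 1, 0 < mixingWeight p prior κ)
    (h : ∀ r, 0 ≤ r → 2 * r * (tiltedMoment (mixingWeight p prior) 2 r
        * tiltedMoment (mixingWeight p prior) 0 r)
      - r * tiltedMoment (mixingWeight p prior) 1 r ^ 2
      ≤ 2 * p * (tiltedMoment (mixingWeight p prior) 1 r
        * tiltedMoment (mixingWeight p prior) 0 r)) :
    BayesMinimax p prior := by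
  obtain ⟨hex, heq⟩ := bayesEstimatorExists_and_eq hm hw hpos
  refine ⟨hex, ?_⟩
  rw [funext heq]
  refine isMinimax_of_risk_le ?_ (risk_shrinkage_tilted_le hw hpos h)
  have := (continuous_shrinkage hw hpos).measurable
  fun_prop

/-! ### Log-adjusted beta weights -/

lemma integrableOn_betaWeight {s b : ℝ} (hs : 0 < s) (hb : 0 < b) :
    IntegrableOn (fun κ : ℝ => κ ^ (s - 1) * (1 - κ) ^ (b - 1)) (Set.Ioo 0 1) := by
  have h := lintegral_betaPDF_eq_one hs hb
  rw [lintegral_betaPDF] at h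
  have hB := beta_pos hs hb
  have hi : IntegrableOn (fun κ : ℝ => 1 / beta s b * κ ^ (s - 1) * (1 - κ) ^ (b - 1))
      (Set.Ioo 0 1) := by
    refine ⟨Measurable.aestronglyMeasurable (by fun_prop), ?_⟩
    rw [hasFiniteIntegral_iff_ofReal, h]
    · exact ENNReal.one_lt_top
    · filter_upwards [ae_restrict_mem measurableSet_Ioo] with κ hκ
      have h0 := hκ.1
      have h1 : 0 < 1 - κ := sub_pos.2 hκ.2
      simp only [Pi.zero_apply]
      positivity
  refine (hi.const_mul (beta s b)).congr (.of_forall fun κ => ?_)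
  simp only
  field_simp

variable {c₁ : ℝ}

lemma one_le_logAdj_base (hc : 0 < c₁) {κ : ℝ} (hκ : κ ∈ Set.Ioo (0 : ℝ) 1) :
    1 ≤ 1 + c₁ * Real.log (1 / κ) := by
  have : 0 ≤ Real.log (1 / κ) := Real.log_nonneg (by rw [le_div_iff₀ hκ.1]; linarith [hκ.2])
  nlinarith

lemma logAdj_pos (hc : 0 < c₁) (c₂ : ℝ) {κ : ℝ} (hκ : κ ∈ Set.Ioo (0 : ℝ) 1) :
    0 < logAdj c₁ c₂ κ :=
  Real.rpow_pos_of_pos (zero_lt_one.trans_le (one_le_logAdj_base hc hκ)) _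

lemma logAdj_le_one (hc : 0 < c₁) {c₂ : ℝ} (h2 : c₂ ≤ 0) {κ : ℝ} (hκ : κ ∈ Set.Ioo (0 : ℝ) 1) :
    logAdj c₁ c₂ κ ≤ 1 :=
  Real.rpow_le_one_of_one_le_of_nonpos (one_le_logAdj_base hc hκ) h2

lemma one_le_logAdj (hc : 0 < c₁) {c₂ : ℝ} (h2 : 0 ≤ c₂) {κ : ℝ} (hκ : κ ∈ Set.Ioo (0 : ℝ) 1) :
    1 ≤ logAdj c₁ c₂ κ :=
  Real.one_le_rpow (one_le_logAdj_base hc hκ) h2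

/-- The log-adjustment grows more slowly at the origin than any negative power. -/
lemma exists_logAdj_le_rpow (hc : 0 < c₁) (c₂ : ℝ) {ε : ℝ} (hε : 0 < ε) :
    ∃ C, 0 < C ∧ ∀ κ ∈ Set.Ioo (0 : ℝ) 1, logAdj c₁ c₂ κ ≤ C * κ ^ (-ε) := by
  rcases le_or_gt c₂ 0 with h2 | h2
  · refine ⟨1, one_pos, fun κ hκ => (logAdj_le_one hc h2 hκ).trans ?_⟩
    rw [one_mul]
    exact Real.one_le_rpow_of_pos_of_le_one_of_nonpos hκ.1 hκ.2.le (by linarith)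
  · have hδ : 0 < ε / c₂ := by positivity
    -- From log x ≤ x^δ/δ with δ = ε/c₂, the base is at most (1 + c₁/δ)κ^(-δ); raising to the power
    -- c₂ gives κ^(-ε).
    refine ⟨(1 + c₁ / (ε / c₂)) ^ c₂, by positivity, fun κ hκ => ?_⟩
    have h0 := hκ.1
    have e1 : Real.log (1 / κ) ≤ κ ^ (-(ε / c₂)) / (ε / c₂) := by
      have := Real.log_le_rpow_div (show 0 ≤ 1 / κ by positivity) hδ
      rwa [one_div, Real.inv_rpow h0.le, ← Real.rpow_neg h0.le, ← one_div] at this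
    have e2 : 1 ≤ κ ^ (-(ε / c₂)) :=
      Real.one_le_rpow_of_pos_of_le_one_of_nonpos h0 hκ.2.le (by linarith)
    have e3 : 1 + c₁ * Real.log (1 / κ) ≤ (1 + c₁ / (ε / c₂)) * κ ^ (-(ε / c₂)) := by
      have := mul_le_mul_of_nonneg_left e1 hc.le
      calc _ ≤ κ ^ (-(ε / c₂)) + c₁ * (κ ^ (-(ε / c₂)) / (ε / c₂)) := by linarith
        _ = _ := by ring
    calc logAdj c₁ c₂ κ ≤ ((1 + c₁ / (ε / c₂)) * κ ^ (-(ε / c₂))) ^ c₂ :=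
          Real.rpow_le_rpow (zero_le_one.trans (one_le_logAdj_base hc hκ)) e3 h2.le
      _ = _ := by
          rw [Real.mul_rpow (by positivity) (by positivity), ← Real.rpow_mul h0.le]
          congr 2
          field_simp

lemma measurable_kappaPrior (a b c₁ c₂ : ℝ) : Measurable (kappaPrior a b (logAdj c₁ c₂)) := by
  unfold kappaPrior logAdj
  fun_prop

lemma kappaPrior_pos (hc : 0 < c₁) (s b c₂ : ℝ) {κ : ℝ} (hκ : κ ∈ Set.Ioo (0 : ℝ) 1) :
    0 < kappaPrior s b (logAdj c₁ c₂) κ := by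
  have h1 : 0 < 1 - κ := sub_pos.2 hκ.2
  have h0 := hκ.1
  have := logAdj_pos hc c₂ hκ
  unfold kappaPrior
  positivity

lemma rpow_mul_kappaPrior (s t b : ℝ) (h : ℝ → ℝ) {κ : ℝ} (hκ : 0 < κ) :
    κ ^ t * kappaPrior s b h κ = kappaPrior (t + s) b h κ := by
  rw [kappaPrior, kappaPrior, add_sub_assoc, Real.rpow_add hκ]
  ring

lemma mul_kappaPrior (s b : ℝ) (h : ℝ → ℝ) {κ : ℝ} (hκ : 0 < κ) :
    κ * kappaPrior s b h κ = kappaPrior (s + 1) b h κ := by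
  rw [add_comm, ← rpow_mul_kappaPrior s 1 b h hκ, Real.rpow_one]

lemma exists_kappaPrior_le (hc : 0 < c₁) (s b c₂ : ℝ) {ε : ℝ} (hε : 0 < ε) :
    ∃ C, 0 < C ∧ ∀ κ ∈ Set.Ioo (0 : ℝ) 1,
      kappaPrior s b (logAdj c₁ c₂) κ ≤ C * (κ ^ (s - ε - 1) * (1 - κ) ^ (b - 1)) := by
  obtain ⟨C, hC, h⟩ := exists_logAdj_le_rpow hc c₂ hε
  refine ⟨C, hC, fun κ hκ => ?_⟩
  have h1 : 0 < 1 - κ := sub_pos.2 hκ.2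
  have h0 := hκ.1
  calc _ ≤ κ ^ (s - 1) * (1 - κ) ^ (b - 1) * (C * κ ^ (-ε)) :=
        mul_le_mul_of_nonneg_left (h κ hκ) (by positivity)
    _ = _ := by
        rw [show s - ε - 1 = (s - 1) + -ε by ring, Real.rpow_add h0]
        ring

lemma integrableOn_kappaPrior (hc : 0 < c₁) {s b : ℝ} (c₂ : ℝ) (hs : 0 < s) (hb : 0 < b) :
    IntegrableOn (kappaPrior s b (logAdj c₁ c₂)) (Set.Ioo 0 1) := by
  obtain ⟨C, hC, h⟩ := exists_kappaPrior_le hc s b c₂ (half_pos hs)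
  refine ((integrableOn_betaWeight (s := s - s / 2) (by linarith) hb).const_mul C).mono'
    (measurable_kappaPrior s b c₁ c₂).aestronglyMeasurable ?_
  filter_upwards [ae_restrict_mem measurableSet_Ioo] with κ hκ
  rw [Real.norm_of_nonneg (kappaPrior_pos hc s b c₂ hκ).le]
  exact h κ hκ

/-- With a nonpositive log exponent the weight `κ⁻¹ (1 - κ) ^ (b - 1) h(κ)` is integrable as soon as
`κ⁻¹ h(κ)` is. -/
lemma integrableOn_kappaPrior_zero (hc : 0 < c₁) {b c₂ : ℝ} (hb : 0 < b) (hb1 : b < 1)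
    (h2 : c₂ ≤ 0)
    (hfin : (∫⁻ κ in Set.Ioo (0 : ℝ) 1, ENNReal.ofReal (κ⁻¹ * logAdj c₁ c₂ κ)) < ⊤) :
    IntegrableOn (kappaPrior 0 b (logAdj c₁ c₂)) (Set.Ioo 0 1) := by
  have hi : IntegrableOn (fun κ : ℝ => κ⁻¹ * logAdj c₁ c₂ κ) (Set.Ioo 0 1) := by
    refine ⟨Measurable.aestronglyMeasurable (by unfold logAdj; fun_prop), ?_⟩
    rw [hasFiniteIntegral_iff_ofReal]
    · exact hfin
    · filter_upwards [ae_restrict_mem measurableSet_Ioo] with κ hκ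
      exact mul_nonneg (inv_nonneg.2 hκ.1.le) (logAdj_pos hc c₂ hκ).le
  refine ((hi.const_mul ((1 / 2) ^ (b - 1))).add
    ((integrableOn_betaWeight one_pos hb).const_mul 2)).mono'
    (measurable_kappaPrior 0 b c₁ c₂).aestronglyMeasurable ?_
  filter_upwards [ae_restrict_mem measurableSet_Ioo] with κ hκ
  have h1 : 0 < 1 - κ := sub_pos.2 hκ.2
  have h0 := hκ.1
  have hl := logAdj_pos hc c₂ hκ
  have hp := Real.rpow_pos_of_pos h1 (b - 1)
  rw [Real.norm_of_nonneg (kappaPrior_pos hc 0 b c₂ hκ).le, kappaPrior, zero_sub, Real.rpow_neg_one]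
  simp only [Pi.add_apply, sub_self, Real.rpow_zero, one_mul]
  -- Only one factor is singular on each half: left of 1/2 the power of 1 - κ is bounded since b <
  -- 1, and right of it κ⁻¹ ≤ 2 and h ≤ 1.
  rcases le_total κ (1 / 2) with hk | hk
  · have e : (1 - κ) ^ (b - 1) ≤ (1 / 2) ^ (b - 1) :=
      Real.rpow_le_rpow_of_nonpos (by norm_num) (by linarith) (by linarith)
    have := mul_le_mul_of_nonneg_right e (show 0 ≤ κ⁻¹ * logAdj c₁ c₂ κ by positivity)
    nlinarith
  · have e : κ⁻¹ ≤ 2 := by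
      rw [inv_le_comm₀ h0 two_pos]
      linarith
    have e2 : κ⁻¹ * (1 - κ) ^ (b - 1) * logAdj c₁ c₂ κ ≤ 2 * (1 - κ) ^ (b - 1) * 1 := by
      have := logAdj_le_one hc h2 hκ
      gcongr
    have : 0 ≤ (1 / 2 : ℝ) ^ (b - 1) * (κ⁻¹ * logAdj c₁ c₂ κ) := by positivity
    linarith

/-! ### Integration by parts -/

lemma exp_sub_exp_nonneg {z κ : ℝ} (hz : 0 ≤ z) (hκ : κ ≤ 1) :
    0 ≤ Real.exp (-(z * κ)) - Real.exp (-z) := by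
  rw [sub_nonneg, Real.exp_le_exp]
  nlinarith

/-- This is 1 + x ≤ exp x at x = -z(1 - κ). The linear vanishing at κ = 1 offsets one power of (1 -
κ)⁻¹. -/
lemma exp_sub_exp_le (z κ : ℝ) :
    Real.exp (-(z * κ)) - Real.exp (-z) ≤ z * (1 - κ) * Real.exp (-(z * κ)) := by
  have h : Real.exp (-z) = Real.exp (-(z * κ)) * Real.exp (-(z * (1 - κ))) := by
    rw [← Real.exp_add]; congr 1; ring
  have h2 := Real.add_one_le_exp (-(z * (1 - κ)))
  rw [h]
  nlinarith [Real.exp_pos (-(z * κ))]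

/-- The reciprocal of the base of the log-adjustment. -/
noncomputable def logWeight (c₁ κ : ℝ) : ℝ := (1 + c₁ * Real.log (1 / κ))⁻¹

lemma logWeight_pos (hc : 0 < c₁) {κ : ℝ} (hκ : κ ∈ Set.Ioo (0 : ℝ) 1) : 0 < logWeight c₁ κ :=
  inv_pos.2 (zero_lt_one.trans_le (one_le_logAdj_base hc hκ))

lemma logWeight_le_one (hc : 0 < c₁) {κ : ℝ} (hκ : κ ∈ Set.Ioo (0 : ℝ) 1) : logWeight c₁ κ ≤ 1 :=
  inv_le_one_of_one_le₀ (one_le_logAdj_base hc hκ)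

@[fun_prop]
lemma measurable_logWeight (c₁ : ℝ) : Measurable (logWeight c₁) := by
  unfold logWeight
  fun_prop

lemma monotoneOn_logWeight (hc : 0 < c₁) : MonotoneOn (logWeight c₁) (Set.Ioo 0 1) := by
  intro x hx y hy hxy
  refine inv_anti₀ (zero_lt_one.trans_le (one_le_logAdj_base hc hy)) ?_
  have : Real.log (1 / y) ≤ Real.log (1 / x) :=
    Real.log_le_log (one_div_pos.2 hy.1) (one_div_le_one_div_of_le hx.1 hxy)
  nlinarith

/-- Logarithmic differentiation: the power of κ contributes s/κ, the log-adjustment -c₁c₂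
`logWeight`/κ, and the power of 1 - κ contributes (1 - b)/(1 - κ). -/
lemma hasDerivAt_kappaPrior (hc : 0 < c₁) (s b c₂ : ℝ) {κ : ℝ} (hκ : κ ∈ Set.Ioo (0 : ℝ) 1) :
    HasDerivAt (kappaPrior (s + 1) b (logAdj c₁ c₂))
      ((s - c₁ * c₂ * logWeight c₁ κ) * kappaPrior s b (logAdj c₁ c₂) κ
        + (1 - b) * (kappaPrior (s + 1) b (logAdj c₁ c₂) κ / (1 - κ))) κ := by
  have h1 : 0 < 1 - κ := sub_pos.2 hκ.2
  have h0 := hκ.1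
  have hL := zero_lt_one.trans_le (one_le_logAdj_base hc hκ)
  have d1 : HasDerivAt (fun κ : ℝ => κ ^ (s + 1 - 1)) ((s + 1 - 1) * κ ^ (s + 1 - 1 - 1)) κ :=
    Real.hasDerivAt_rpow_const (Or.inl h0.ne')
  have d2 : HasDerivAt (fun κ : ℝ => (1 - κ) ^ (b - 1)) (-1 * (b - 1) * (1 - κ) ^ (b - 1 - 1)) κ :=
    ((hasDerivAt_id κ).const_sub 1).rpow_const (Or.inl h1.ne')
  have d3 : HasDerivAt (fun κ : ℝ => 1 + c₁ * Real.log (1 / κ)) (c₁ * -κ⁻¹) κ := by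
    have : (fun κ : ℝ => 1 + c₁ * Real.log (1 / κ)) = fun κ => 1 + c₁ * -Real.log κ := by
      funext κ; simp
    rw [this]
    exact (((Real.hasDerivAt_log h0.ne').neg).const_mul c₁).const_add 1
  have d4 : HasDerivAt (logAdj c₁ c₂) _ κ := d3.rpow_const (p := c₂) (Or.inl hL.ne')
  refine ((d1.mul d2).mul d4).congr_deriv ?_
  have r1 : κ ^ (s - 1) = κ ^ s / κ := Real.rpow_sub_one h0.ne' s
  have r2 : (1 - κ) ^ (b - 1 - 1) = (1 - κ) ^ (b - 1) / (1 - κ) := Real.rpow_sub_one h1.ne' _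
  have r3 : (1 + c₁ * Real.log (1 / κ)) ^ (c₂ - 1)
      = (1 + c₁ * Real.log (1 / κ)) ^ c₂ / (1 + c₁ * Real.log (1 / κ)) := Real.rpow_sub_one hL.ne' _
  simp only [kappaPrior, logAdj, logWeight, add_sub_cancel_right, r1, r2, r3, Pi.mul_apply]
  have hL' := hL.ne'
  generalize 1 + c₁ * Real.log (1 / κ) = L at *
  field_simp
  ring

section IntegrationByParts

variable {s b c₂ z : ℝ}

lemma integrableOn_mul_exp_sub_exp {u g : ℝ → ℝ} (hu : IntegrableOn u (Set.Ioo 0 1))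
    (hg : Measurable g) (hg1 : ∀ κ ∈ Set.Ioo (0 : ℝ) 1, |g κ| ≤ 1) (hz : 0 ≤ z) :
    IntegrableOn (fun κ => g κ * (u κ * (Real.exp (-(z * κ)) - Real.exp (-z)))) (Set.Ioo 0 1) := by
  have : IntegrableOn (fun κ => u κ * (g κ * (Real.exp (-(z * κ)) - Real.exp (-z))))
      (Set.Ioo 0 1) := by
    refine Integrable.mul_bdd (c := 1) hu (Measurable.aestronglyMeasurable (by fun_prop)) ?_
    filter_upwards [ae_restrict_mem measurableSet_Ioo] with κ hκ
    rw [norm_mul, Real.norm_eq_abs, Real.norm_of_nonneg (exp_sub_exp_nonneg hz hκ.2.le)]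
    refine mul_le_one₀ (hg1 κ hκ) (exp_sub_exp_nonneg hz hκ.2.le) ?_
    have h1 : Real.exp (-(z * κ)) ≤ 1 := Real.exp_le_one_iff.2 (by nlinarith [hκ.1])
    linarith [Real.exp_pos (-z)]
  exact this.congr (.of_forall fun κ => by ring)

lemma integrableOn_mul_exp {u : ℝ → ℝ} (hu : IntegrableOn u (Set.Ioo 0 1)) (hz : 0 ≤ z) :
    IntegrableOn (fun κ => u κ * Real.exp (-(z * κ))) (Set.Ioo 0 1) := by
  refine Integrable.mul_bdd (c := 1) hu (by fun_prop) ?_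
  filter_upwards [ae_restrict_mem measurableSet_Ioo] with κ hκ
  rw [Real.norm_of_nonneg (Real.exp_pos _).le]
  exact Real.exp_le_one_iff.2 (by nlinarith [hκ.1])

lemma integrableOn_div_mul_exp_sub_exp {u : ℝ → ℝ} (hu : IntegrableOn u (Set.Ioo 0 1))
    (hz : 0 ≤ z) : IntegrableOn
      (fun κ => u κ / (1 - κ) * (Real.exp (-(z * κ)) - Real.exp (-z))) (Set.Ioo 0 1) := by
  have : IntegrableOn (fun κ => u κ * ((Real.exp (-(z * κ)) - Real.exp (-z)) / (1 - κ)))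
      (Set.Ioo 0 1) := by
    refine Integrable.mul_bdd (c := z) hu (Measurable.aestronglyMeasurable (by fun_prop)) ?_
    filter_upwards [ae_restrict_mem measurableSet_Ioo] with κ hκ
    have h1 : 0 < 1 - κ := sub_pos.2 hκ.2
    rw [Real.norm_of_nonneg (div_nonneg (exp_sub_exp_nonneg hz hκ.2.le) h1.le), div_le_iff₀ h1]
    refine (exp_sub_exp_le z κ).trans (mul_le_of_le_one_right (by positivity) ?_)
    exact Real.exp_le_one_iff.2 (by nlinarith [hκ.1])
  exact this.congr (.of_forall fun κ => by ring)

/-- Integrate the derivative of κ^s (1 - κ)^(b-1) h(κ) (exp(-zκ) - exp(-z)). The boundary term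
vanishes at 0 because s > 0, and at 1 because of the subtracted exp(-z). -/
lemma integral_kappaPrior_by_parts (hc : 0 < c₁) (hs : 0 < s) (hb : 0 < b) (hz : 0 ≤ z) :
    z * ∫ κ in Set.Ioo 0 1, kappaPrior (s + 1) b (logAdj c₁ c₂) κ * Real.exp (-(z * κ))
      = s * (∫ κ in Set.Ioo 0 1, kappaPrior s b (logAdj c₁ c₂) κ
          * (Real.exp (-(z * κ)) - Real.exp (-z)))
        - c₁ * c₂ * (∫ κ in Set.Ioo 0 1, logWeight c₁ κ * (kappaPrior s b (logAdj c₁ c₂) κ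
          * (Real.exp (-(z * κ)) - Real.exp (-z))))
        + (1 - b) * ∫ κ in Set.Ioo 0 1, kappaPrior (s + 1) b (logAdj c₁ c₂) κ / (1 - κ)
          * (Real.exp (-(z * κ)) - Real.exp (-z)) := by
  set u := kappaPrior s b (logAdj c₁ c₂) with hu
  set f := kappaPrior (s + 1) b (logAdj c₁ c₂) with hf
  set G : ℝ → ℝ := fun κ => Real.exp (-(z * κ)) - Real.exp (-z) with hG
  have hui : IntegrableOn u (Set.Ioo 0 1) := integrableOn_kappaPrior hc c₂ hs hb
  have hfi : IntegrableOn f (Set.Ioo 0 1) := integrableOn_kappaPrior hc c₂ (by linarith) hb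
  have j1 : IntegrableOn (fun κ => u κ * G κ) (Set.Ioo 0 1) := by
    simpa using integrableOn_mul_exp_sub_exp (g := fun _ => 1) hui measurable_const (by simp) hz
  have j2 : IntegrableOn (fun κ => logWeight c₁ κ * (u κ * G κ)) (Set.Ioo 0 1) :=
    integrableOn_mul_exp_sub_exp hui (by fun_prop) (fun _ hκ => by
      rw [abs_of_pos (logWeight_pos hc hκ)]; exact logWeight_le_one hc hκ) hz
  have j3 : IntegrableOn (fun κ => f κ / (1 - κ) * G κ) (Set.Ioo 0 1) :=
    integrableOn_div_mul_exp_sub_exp hfi hz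
  have j4 : IntegrableOn (fun κ => f κ * Real.exp (-(z * κ))) (Set.Ioo 0 1) :=
    integrableOn_mul_exp hfi hz
  have k1 := j1.const_mul s
  have k2 := j2.const_mul (c₁ * c₂)
  have k3 := j3.const_mul (1 - b)
  have k4 := j4.const_mul z
  have k12 : IntegrableOn (fun κ => s * (u κ * G κ) - c₁ * c₂ * (logWeight c₁ κ * (u κ * G κ)))
    (Set.Ioo 0 1) := k1.sub k2
  have k123 : IntegrableOn (fun κ => s * (u κ * G κ) - c₁ * c₂ * (logWeight c₁ κ * (u κ * G κ))
    + (1 - b) * (f κ / (1 - κ) * G κ)) (Set.Ioo 0 1) := k12.add k3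
  obtain ⟨C, hC, hCf⟩ := exists_kappaPrior_le hc (s + 1) b c₂ (half_pos hs)
  -- Half of the exponent `s` is spent on the log-adjustment; the bracket raises the power of 1 - κ
  -- from b - 1 to b > 0.
  have hbound : ∀ κ ∈ Set.Ioo (0 : ℝ) 1, f κ * G κ ≤ z * C * (κ ^ (s / 2) * (1 - κ) ^ b) := by
    intro κ hκ
    have h1 : 0 < 1 - κ := sub_pos.2 hκ.2
    have h0 := hκ.1
    have hexp : Real.exp (-(z * κ)) ≤ 1 := Real.exp_le_one_iff.2 (by nlinarith)
    have hGle : G κ ≤ z * (1 - κ) :=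
      (exp_sub_exp_le z κ).trans (mul_le_of_le_one_right (by positivity) hexp)
    calc f κ * G κ ≤ C * (κ ^ (s + 1 - s / 2 - 1) * (1 - κ) ^ (b - 1)) * (z * (1 - κ)) :=
          mul_le_mul (hCf κ hκ) hGle (exp_sub_exp_nonneg hz hκ.2.le) (by positivity)
      _ = _ := by
          rw [show s + 1 - s / 2 - 1 = s / 2 by ring, Real.rpow_sub_one h1.ne']
          field_simp
  have hnn : ∀ κ ∈ Set.Ioo (0 : ℝ) 1, 0 ≤ f κ * G κ := fun κ hκ =>
    mul_nonneg (kappaPrior_pos hc _ b c₂ hκ).le (exp_sub_exp_nonneg hz hκ.2.le)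
  have hcont : Continuous fun κ : ℝ => z * C * (κ ^ (s / 2) * (1 - κ) ^ b) := by
    have := Real.continuous_rpow_const (q := s / 2) (by positivity)
    have h2 := (Real.continuous_rpow_const hb.le).comp (continuous_sub_left (1 : ℝ))
    exact continuous_const.mul (this.mul h2)
  have lim0 : Filter.Tendsto (fun κ => f κ * G κ) (nhdsWithin 0 (Set.Ioi 0)) (nhds 0) := by
    have h0 := (hcont.tendsto 0).mono_left (nhdsWithin_le_nhds (s := Set.Ioi 0))
    simp only [Real.zero_rpow (half_pos hs).ne', zero_mul, mul_zero] at h0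
    refine squeeze_zero' ?_ ?_ h0
    · filter_upwards [Ioo_mem_nhdsGT one_pos] with κ hκ using hnn κ hκ
    · filter_upwards [Ioo_mem_nhdsGT one_pos] with κ hκ using hbound κ hκ
  have lim1 : Filter.Tendsto (fun κ => f κ * G κ) (nhdsWithin 1 (Set.Iio 1)) (nhds 0) := by
    have h0 := (hcont.tendsto 1).mono_left (nhdsWithin_le_nhds (s := Set.Iio 1))
    simp only [sub_self, Real.zero_rpow hb.ne', mul_zero] at h0
    refine squeeze_zero' ?_ ?_ h0
    · filter_upwards [Ioo_mem_nhdsLT one_pos] with κ hκ using hnn κ hκ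
    · filter_upwards [Ioo_mem_nhdsLT one_pos] with κ hκ using hbound κ hκ
  have hderiv : ∀ κ ∈ Set.Ioo (0 : ℝ) 1, HasDerivAt (fun κ => f κ * G κ)
      (s * (u κ * G κ) - c₁ * c₂ * (logWeight c₁ κ * (u κ * G κ))
        + (1 - b) * (f κ / (1 - κ) * G κ) - z * (f κ * Real.exp (-(z * κ)))) κ := by
    intro κ hκ
    have hGd : HasDerivAt G (Real.exp (-(z * κ)) * -(z * 1)) κ :=
      ((((hasDerivAt_id κ).const_mul z).neg).exp).sub_const _
    refine ((hasDerivAt_kappaPrior hc s b c₂ hκ).mul hGd).congr_deriv ?_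
    ring
  have hint : IntervalIntegrable (fun κ => s * (u κ * G κ)
      - c₁ * c₂ * (logWeight c₁ κ * (u κ * G κ))
        + (1 - b) * (f κ / (1 - κ) * G κ) - z * (f κ * Real.exp (-(z * κ)))) volume 0 1 :=
    (intervalIntegrable_iff_integrableOn_Ioo_of_le zero_le_one).2 (k123.sub k4)
  have key := intervalIntegral.integral_eq_sub_of_hasDerivAt_of_tendsto one_pos hderiv hint lim0 lim1
  rw [intervalIntegral.integral_of_le zero_le_one, integral_Ioc_eq_integral_Ioo,
    integral_sub k123 k4, integral_add k12 k3, integral_sub k1 k2, integral_const_mul,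
    integral_const_mul, integral_const_mul, integral_const_mul] at key
  linarith

lemma integral_kappaPrior_div_nonneg (hc : 0 < c₁) (hz : 0 ≤ z) :
    0 ≤ ∫ κ in Set.Ioo 0 1, kappaPrior s b (logAdj c₁ c₂) κ / (1 - κ)
      * (Real.exp (-(z * κ)) - Real.exp (-z)) :=
  setIntegral_nonneg measurableSet_Ioo fun _ hκ =>
    mul_nonneg (div_nonneg (kappaPrior_pos hc s b c₂ hκ).le (sub_pos.2 hκ.2).le)
      (exp_sub_exp_nonneg hz hκ.2.le)

lemma integral_kappaPrior_div_le (hc : 0 < c₁) (hs : 0 < s) (hb : 0 < b) (hz : 0 ≤ z) :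
    ∫ κ in Set.Ioo 0 1, kappaPrior s b (logAdj c₁ c₂) κ / (1 - κ)
      * (Real.exp (-(z * κ)) - Real.exp (-z))
    ≤ z * ∫ κ in Set.Ioo 0 1, kappaPrior s b (logAdj c₁ c₂) κ * Real.exp (-(z * κ)) := by
  have hi := integrableOn_kappaPrior hc c₂ hs hb
  rw [← integral_const_mul]
  refine setIntegral_mono_on (integrableOn_div_mul_exp_sub_exp hi hz)
    ((integrableOn_mul_exp hi hz).const_mul z) measurableSet_Ioo fun κ hκ => ?_
  have h1 : 0 < 1 - κ := sub_pos.2 hκ.2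
  calc _ ≤ kappaPrior s b (logAdj c₁ c₂) κ / (1 - κ) * (z * (1 - κ) * Real.exp (-(z * κ))) :=
        mul_le_mul_of_nonneg_left (exp_sub_exp_le z κ)
          (div_nonneg (kappaPrior_pos hc s b c₂ hκ).le h1.le)
    _ = _ := by field_simp

end IntegrationByParts

/-- **Chebyshev's integral inequality** on the unit interval, one function being the identity. -/
lemma chebyshev_integral_id {v f : ℝ → ℝ} (hv : IntegrableOn v (Set.Ioo 0 1))
    (hpos : ∀ κ ∈ Set.Ioo (0 : ℝ) 1, 0 < v κ) (hf : MonotoneOn f (Set.Ioo 0 1))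
    (hfv : IntegrableOn (fun κ => f κ * v κ) (Set.Ioo 0 1)) :
    (∫ κ in Set.Ioo 0 1, f κ * v κ) * (∫ κ in Set.Ioo 0 1, κ * v κ)
      ≤ (∫ κ in Set.Ioo 0 1, f κ * (κ * v κ)) * ∫ κ in Set.Ioo 0 1, v κ := by
  have hbd : ∀ g : ℝ → ℝ, IntegrableOn g (Set.Ioo 0 1) →
      IntegrableOn (fun κ => κ * g κ) (Set.Ioo 0 1) := fun g hg => by
    refine Integrable.bdd_mul (c := 1) hg (by fun_prop) ?_
    filter_upwards [ae_restrict_mem measurableSet_Ioo] with κ hκ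
    rw [Real.norm_of_nonneg hκ.1.le]
    exact hκ.2.le
  have hp : ∀ g : ℝ → ℝ, IntegrableOn g (Set.Ioo 0 1) → (∀ κ ∈ Set.Ioo (0 : ℝ) 1, 0 < g κ) →
      0 < ∫ κ in Set.Ioo 0 1, g κ := fun g hg h => by
    have := tiltedMoment_pos hg h 0 0
    simpa [tiltedMoment] using this
  have i1 := hbd v hv
  have i2 := hbd _ hfv
  have p0 := hp v hv hpos
  have p1 := hp _ i1 fun κ hκ => mul_pos hκ.1 (hpos κ hκ)
  have p2 := hp _ (hv.sub i1) fun κ hκ => by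
    simp only [Pi.sub_apply]
    nlinarith [hpos κ hκ, hκ.2]
  have e2 : ∫ κ in Set.Ioo 0 1, (v - fun κ => κ * v κ) κ
      = (∫ κ in Set.Ioo 0 1, v κ) - ∫ κ in Set.Ioo 0 1, κ * v κ := integral_sub hv i1
  rw [e2] at p2
  set A := ∫ κ in Set.Ioo 0 1, v κ
  set B := ∫ κ in Set.Ioo 0 1, κ * v κ
  -- The pivot B/A is the mean of κ under the normalized weight. Integrating (f(κ) - f(B/A))(κ -
  -- B/A) ≥ 0 makes the f(B/A) term drop out, so no double integral is needed.
  have hm : B / A ∈ Set.Ioo (0 : ℝ) 1 := ⟨by positivity, by rw [div_lt_one p0]; linarith⟩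
  have hnn : 0 ≤ ∫ κ in Set.Ioo 0 1, ((κ * (f κ * v κ) - B / A * (f κ * v κ))
      - f (B / A) * (κ * v κ - B / A * v κ)) := by
    refine setIntegral_nonneg measurableSet_Ioo fun κ hκ => ?_
    have h1 : 0 ≤ (f κ - f (B / A)) * (κ - B / A) := by
      rcases le_total κ (B / A) with h | h
      · exact mul_nonneg_of_nonpos_of_nonpos (sub_nonpos.2 (hf hκ hm h)) (sub_nonpos.2 h)
      · exact mul_nonneg (sub_nonneg.2 (hf hm hκ h)) (sub_nonneg.2 h)
    have := mul_nonneg h1 (hpos κ hκ).le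
    linarith
  have k1 : IntegrableOn (fun κ => κ * (f κ * v κ) - B / A * (f κ * v κ)) (Set.Ioo 0 1) :=
    i2.sub (hfv.const_mul _)
  have k2 : IntegrableOn (fun κ => κ * v κ - B / A * v κ) (Set.Ioo 0 1) := i1.sub (hv.const_mul _)
  rw [integral_sub k1 (k2.const_mul _), integral_sub i2 (hfv.const_mul _), integral_const_mul,
    integral_const_mul, integral_sub i1 (hv.const_mul _), integral_const_mul] at hnn
  change 0 ≤ _ - _ - f (B / A) * (B - B / A * A) at hnn
  rw [div_mul_cancel₀ _ p0.ne', sub_self, mul_zero, sub_zero, sub_nonneg, div_mul_eq_mul_div,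
    div_le_iff₀ p0] at hnn
  calc _ = B * ∫ κ in Set.Ioo 0 1, f κ * v κ := mul_comm _ _
    _ ≤ (∫ κ in Set.Ioo 0 1, κ * (f κ * v κ)) * A := hnn
    _ = _ := by simp_rw [mul_left_comm]

/-! ### The risk inequality -/

section RiskInequality

/-- The Laplace transform of the log-adjusted beta weight. -/
noncomputable def laplaceWeight (b c₁ c₂ s z : ℝ) : ℝ :=
  ∫ κ in Set.Ioo 0 1, kappaPrior s b (logAdj c₁ c₂) κ * Real.exp (-(z * κ))

/-- The Laplace transform minus its limiting exponential part. -/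
noncomputable def reducedWeight (b c₁ c₂ s z : ℝ) : ℝ :=
  ∫ κ in Set.Ioo 0 1, kappaPrior s b (logAdj c₁ c₂) κ * (Real.exp (-(z * κ)) - Real.exp (-z))

/-- The reduced Laplace transform of the weight multiplied by the logarithmic weight. -/
noncomputable def reducedLogWeight (b c₁ c₂ s z : ℝ) : ℝ :=
  ∫ κ in Set.Ioo 0 1, logWeight c₁ κ
    * (kappaPrior s b (logAdj c₁ c₂) κ * (Real.exp (-(z * κ)) - Real.exp (-z)))

variable {b c₁ c₂ s z : ℝ}

/-- The (1 - b) term of the integration by parts is at most (1 - b) times the left side; moving it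
across leaves the factor `b`. -/
lemma mul_laplaceWeight_le (hc : 0 < c₁) (hs : 0 < s) (hb : 0 < b) (hb1 : b < 1) (hz : 0 ≤ z) :
    b * (z * laplaceWeight b c₁ c₂ (s + 1) z)
      ≤ s * reducedWeight b c₁ c₂ s z - c₁ * c₂ * reducedLogWeight b c₁ c₂ s z := by
  have h1 := integral_kappaPrior_by_parts (c₂ := c₂) hc hs hb hz
  have h2 := integral_kappaPrior_div_le (c₂ := c₂) hc (show 0 < s + 1 by linarith) hb hz
  have h3 := mul_le_mul_of_nonneg_left h2 (sub_nonneg.2 hb1.le)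
  unfold laplaceWeight reducedWeight reducedLogWeight
  linarith

lemma le_mul_laplaceWeight (hc : 0 < c₁) (hs : 0 < s) (hb : 0 < b) (hb1 : b < 1) (hz : 0 ≤ z) :
    s * reducedWeight b c₁ c₂ s z - c₁ * c₂ * reducedLogWeight b c₁ c₂ s z
      ≤ z * laplaceWeight b c₁ c₂ (s + 1) z := by
  have h1 := integral_kappaPrior_by_parts (c₂ := c₂) hc hs hb hz
  have h3 := mul_nonneg (sub_nonneg.2 hb1.le)
    (integral_kappaPrior_div_nonneg (s := s + 1) (b := b) (c₂ := c₂) hc hz)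
  unfold laplaceWeight reducedWeight reducedLogWeight
  linarith

lemma laplaceWeight_pos (hc : 0 < c₁)
    (hi : IntegrableOn (kappaPrior s b (logAdj c₁ c₂)) (Set.Ioo 0 1)) :
    0 < laplaceWeight b c₁ c₂ s z := by
  have h := tiltedMoment_pos hi (fun κ hκ => kappaPrior_pos hc s b c₂ hκ) 0 (2 * z)
  simp only [tiltedMoment, pow_zero, one_mul] at h
  have e : ∀ κ : ℝ, κ * (2 * z) / 2 = z * κ := fun κ => by ring
  simp_rw [e] at h
  exact h

lemma reducedWeight_eq (hi : IntegrableOn (kappaPrior s b (logAdj c₁ c₂)) (Set.Ioo 0 1))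
    (hz : 0 ≤ z) : reducedWeight b c₁ c₂ s z
      = laplaceWeight b c₁ c₂ s z - Real.exp (-z) * laplaceWeight b c₁ c₂ s 0 := by
  have i1 := integrableOn_mul_exp hi hz
  unfold reducedWeight laplaceWeight
  rw [← integral_const_mul, ← integral_sub i1 ((integrableOn_mul_exp hi le_rfl).const_mul _)]
  congr 1 with κ
  simp
  ring

lemma reducedLogWeight_nonneg (hc : 0 < c₁) (hz : 0 ≤ z) : 0 ≤ reducedLogWeight b c₁ c₂ s z :=
  setIntegral_nonneg measurableSet_Ioo fun _ hκ => mul_nonneg (logWeight_pos hc hκ).le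
    (mul_nonneg (kappaPrior_pos hc s b c₂ hκ).le (exp_sub_exp_nonneg hz hκ.2.le))

lemma integrableOn_reducedWeight
    (hi : IntegrableOn (kappaPrior s b (logAdj c₁ c₂)) (Set.Ioo 0 1)) (hz : 0 ≤ z) :
    IntegrableOn (fun κ => kappaPrior s b (logAdj c₁ c₂) κ
      * (Real.exp (-(z * κ)) - Real.exp (-z))) (Set.Ioo 0 1) := by
  simpa using integrableOn_mul_exp_sub_exp (g := fun _ => 1) hi measurable_const (by simp) hz

lemma integrableOn_reducedLogWeight (hc : 0 < c₁)
    (hi : IntegrableOn (kappaPrior s b (logAdj c₁ c₂)) (Set.Ioo 0 1)) (hz : 0 ≤ z) :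
    IntegrableOn (fun κ => logWeight c₁ κ * (kappaPrior s b (logAdj c₁ c₂) κ
      * (Real.exp (-(z * κ)) - Real.exp (-z)))) (Set.Ioo 0 1) :=
  integrableOn_mul_exp_sub_exp hi (by fun_prop) (fun κ hκ => by
    rw [abs_of_pos (logWeight_pos hc hκ)]; exact logWeight_le_one hc hκ) hz

lemma reducedLogWeight_le (hc : 0 < c₁)
    (hi : IntegrableOn (kappaPrior s b (logAdj c₁ c₂)) (Set.Ioo 0 1)) (hz : 0 ≤ z) :
    reducedLogWeight b c₁ c₂ s z ≤ reducedWeight b c₁ c₂ s z :=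
  setIntegral_mono_on (integrableOn_reducedLogWeight hc hi hz) (integrableOn_reducedWeight hi hz)
    measurableSet_Ioo fun _ hκ => mul_le_of_le_one_left
      (mul_nonneg (kappaPrior_pos hc s b c₂ hκ).le (exp_sub_exp_nonneg hz hκ.2.le))
      (logWeight_le_one hc hκ)

lemma setIntegral_mul_kappaPrior (f : ℝ → ℝ) (h : ℝ → ℝ) :
    ∫ κ in Set.Ioo 0 1, κ * (kappaPrior s b h κ * f κ)
      = ∫ κ in Set.Ioo 0 1, kappaPrior (s + 1) b h κ * f κ :=
  setIntegral_congr_fun measurableSet_Ioo fun κ hκ => by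
    rw [← mul_assoc, mul_kappaPrior s b h hκ.1]

/-- Chebyshev with the increasing function -exp(-zκ): exponential tilting lowers the mean of κ. -/
lemma laplaceWeight_zero_mul_le (hc : 0 < c₁)
    (hi : IntegrableOn (kappaPrior s b (logAdj c₁ c₂)) (Set.Ioo 0 1)) (hz : 0 ≤ z) :
    laplaceWeight b c₁ c₂ s 0 * laplaceWeight b c₁ c₂ (s + 1) z
      ≤ laplaceWeight b c₁ c₂ (s + 1) 0 * laplaceWeight b c₁ c₂ s z := by
  have h := chebyshev_integral_id (f := fun κ => -Real.exp (-(z * κ))) hi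
    (fun κ hκ => kappaPrior_pos hc s b c₂ hκ) (fun x _ y _ hxy => by
      simp only [neg_le_neg_iff, Real.exp_le_exp]
      nlinarith)
    (by simpa [mul_comm] using (integrableOn_mul_exp hi hz).neg)
  have e1 := setIntegral_mul_kappaPrior (s := s) (b := b) (fun κ => Real.exp (-(z * κ)))
    (logAdj c₁ c₂)
  have e2 := setIntegral_mul_kappaPrior (s := s) (b := b) (fun κ => 1) (logAdj c₁ c₂)
  simp only [mul_one] at e2
  have e3 : ∀ κ, -Real.exp (-(z * κ)) * (κ * kappaPrior s b (logAdj c₁ c₂) κ)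
      = -(κ * (kappaPrior s b (logAdj c₁ c₂) κ * Real.exp (-(z * κ)))) := fun κ => by ring
  have e4 : ∀ κ, -Real.exp (-(z * κ)) * kappaPrior s b (logAdj c₁ c₂) κ
      = -(kappaPrior s b (logAdj c₁ c₂) κ * Real.exp (-(z * κ))) := fun κ => by ring
  simp_rw [e3, e4, integral_neg, e1, e2] at h
  simp only [laplaceWeight, zero_mul, neg_zero, Real.exp_zero, mul_one]
  linarith

/-- Chebyshev with the increasing function `logWeight`; z > 0 makes the reduced weight strictly
positive. -/
lemma reducedLogWeight_mul_le (hc : 0 < c₁)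
    (hi : IntegrableOn (kappaPrior s b (logAdj c₁ c₂)) (Set.Ioo 0 1)) (hz : 0 < z) :
    reducedLogWeight b c₁ c₂ s z * reducedWeight b c₁ c₂ (s + 1) z
      ≤ reducedLogWeight b c₁ c₂ (s + 1) z * reducedWeight b c₁ c₂ s z := by
  have h := chebyshev_integral_id (f := logWeight c₁) (integrableOn_reducedWeight hi hz.le)
    (fun κ hκ => mul_pos (kappaPrior_pos hc s b c₂ hκ) (by
      rw [sub_pos, Real.exp_lt_exp]
      nlinarith [hκ.2])) (monotoneOn_logWeight hc) (integrableOn_reducedLogWeight hc hi hz.le)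
  rw [setIntegral_mul_kappaPrior] at h
  have e : ∫ κ in Set.Ioo 0 1, logWeight c₁ κ * (κ * (kappaPrior s b (logAdj c₁ c₂) κ
      * (Real.exp (-(z * κ)) - Real.exp (-z)))) = reducedLogWeight b c₁ c₂ (s + 1) z :=
    setIntegral_congr_fun measurableSet_Ioo fun κ hκ => by
      rw [← mul_assoc κ, mul_kappaPrior s b _ hκ.1]
  rw [e] at h
  exact h

variable {d : ℝ}

/-- The risk inequality for a positive log exponent. -/
theorem laplaceWeight_le_of_pos (hc : 0 < c₁) (hs : 0 < s) (hb : 0 < b) (hb1 : b < 1) (h2 : 0 < c₂)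
    (hcs : c₁ * c₂ ≤ s + 2) (hbd : 2 * (s + 1) ≤ b * (d + s)) (hd : 0 ≤ d) (hz : 0 ≤ z) :
    2 * z * (laplaceWeight b c₁ c₂ (s + 1 + 1) z * laplaceWeight b c₁ c₂ s z)
      - z * laplaceWeight b c₁ c₂ (s + 1) z ^ 2
      ≤ d * (laplaceWeight b c₁ c₂ (s + 1) z * laplaceWeight b c₁ c₂ s z) := by
  have hi0 := integrableOn_kappaPrior hc c₂ hs hb
  have hi1 := integrableOn_kappaPrior hc c₂ (show 0 < s + 1 by linarith) hb
  have m0 := laplaceWeight_pos (z := z) hc hi0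
  have m1 := laplaceWeight_pos (z := z) hc hi1
  rcases hz.eq_or_lt with rfl | hz'
  · have : 0 ≤ d * (laplaceWeight b c₁ c₂ (s + 1) 0 * laplaceWeight b c₁ c₂ s 0) := by positivity
    linarith
  have b1 := laplaceWeight_pos (z := 0) hc hi1
  have hA := mul_laplaceWeight_le (c₂ := c₂) hc (show 0 < s + 1 by linarith) hb hb1 hz
  have hB := le_mul_laplaceWeight (c₂ := c₂) hc hs hb hb1 hz
  have p0 := reducedWeight_eq hi0 hz
  have p1 := reducedWeight_eq hi1 hz
  have q0 := reducedLogWeight_nonneg (b := b) (c₂ := c₂) (s := s) hc hz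
  have q1 := reducedLogWeight_nonneg (b := b) (c₂ := c₂) (s := s + 1) hc hz
  have q0p := reducedLogWeight_le hc hi0 hz
  have cheb1 := laplaceWeight_zero_mul_le hc hi0 hz
  have cheb2 := reducedLogWeight_mul_le hc hi0 hz'
  have hE := Real.exp_pos (-z)
  have b0 := laplaceWeight_pos (z := 0) hc hi0
  have hcc : 0 < c₁ * c₂ := mul_pos hc h2
  generalize laplaceWeight b c₁ c₂ (s + 1 + 1) z = M2 at *
  generalize laplaceWeight b c₁ c₂ (s + 1) z = M1 at *
  generalize laplaceWeight b c₁ c₂ s z = M0 at *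
  generalize laplaceWeight b c₁ c₂ (s + 1) 0 = B1 at *
  generalize laplaceWeight b c₁ c₂ s 0 = B0 at *
  generalize reducedLogWeight b c₁ c₂ (s + 1) z = Q1 at *
  generalize reducedLogWeight b c₁ c₂ s z = Q0 at *
  generalize reducedWeight b c₁ c₂ (s + 1) z = P1 at *
  generalize reducedWeight b c₁ c₂ s z = P0 at *
  generalize Real.exp (-z) = E at *
  generalize c₁ * c₂ = c at *
  have hA' := mul_le_mul_of_nonneg_right hA m0.le
  have hB' := mul_le_mul_of_nonneg_right hB m1.le
  have hB'' := mul_le_mul_of_nonneg_left hB' hb.le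
  have hEB := mul_pos hE b1
  -- Chebyshev controls the reduced part P1 of M1; the leftover exp(-z) part costs M0·E·B1, because
  -- Q0 ≤ P0 ≤ M0.
  have hQ : Q0 * M1 ≤ Q1 * M0 + M0 * (E * B1) := by
    have e1 : M1 = P1 + E * B1 := by linarith
    have e2 : P0 ≤ M0 := by linarith [mul_pos hE b0]
    calc Q0 * M1 = Q0 * P1 + Q0 * (E * B1) := by rw [e1]; ring
      _ ≤ Q1 * P0 + M0 * (E * B1) :=
        add_le_add cheb2 (mul_le_mul_of_nonneg_right (q0p.trans e2) hEB.le)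
      _ ≤ _ := by gcongr
  have hQc : b * (c * (Q0 * M1)) ≤ c * (Q1 * M0) + c * (M0 * (E * B1)) := by
    have hnn : 0 ≤ c * (Q0 * M1) := by positivity
    calc b * (c * (Q0 * M1)) ≤ c * (Q0 * M1) := mul_le_of_le_one_left hnn hb1.le
      _ ≤ c * (Q1 * M0 + M0 * (E * B1)) := mul_le_mul_of_nonneg_left hQ hcc.le
      _ = _ := by ring
  have hs1 : b * (s * (E * (B0 * M1))) ≤ s * (E * (B1 * M0)) := by
    have hnn : 0 ≤ s * (E * (B0 * M1)) := by positivity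
    calc _ ≤ s * (E * (B0 * M1)) := mul_le_of_le_one_left hnn hb1.le
      _ ≤ _ := by gcongr
  have hdM := mul_le_mul_of_nonneg_right hbd (mul_pos m1 m0).le
  have hcM : c * (E * (B1 * M0)) ≤ (s + 2) * (E * (B1 * M0)) :=
    mul_le_mul_of_nonneg_right hcs (by positivity)
  have hQ1 : 0 ≤ c * (Q1 * M0) := by positivity
  -- After multiplying by `b`, the main terms are covered by `hbd`. The remainder is at most (c - s
  -- - 2)·E·B1·M0 - c·Q1·M0, which is nonpositive since c ≤ s + 2.
  refine le_of_mul_le_mul_left ?_ hb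
  subst p0 p1
  nlinarith [hA', hB'', hQc, hs1, hdM, hcM, hQ1]

/-- The risk inequality for a negative log exponent. -/
theorem laplaceWeight_le_of_neg (hc : 0 < c₁) (hs : 0 ≤ s) (hb : 0 < b) (hb1 : b < 1) (h2 : c₂ < 0)
    (hi0 : IntegrableOn (kappaPrior s b (logAdj c₁ c₂)) (Set.Ioo 0 1))
    (hbd : 2 * (s + 1) - 2 * (c₁ * c₂) ≤ b * (d + s)) (hz : 0 ≤ z) :
    2 * z * (laplaceWeight b c₁ c₂ (s + 1 + 1) z * laplaceWeight b c₁ c₂ s z)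
      - z * laplaceWeight b c₁ c₂ (s + 1) z ^ 2
      ≤ d * (laplaceWeight b c₁ c₂ (s + 1) z * laplaceWeight b c₁ c₂ s z) := by
  have hi1 := integrableOn_kappaPrior hc c₂ (show 0 < s + 1 by linarith) hb
  have m0 := laplaceWeight_pos (z := z) hc hi0
  have m1 := laplaceWeight_pos (z := z) hc hi1
  have b1 := laplaceWeight_pos (z := 0) hc hi1
  have b0 := laplaceWeight_pos (z := 0) hc hi0
  have hcc : c₁ * c₂ < 0 := mul_neg_of_pos_of_neg hc h2
  have hA : b * (z * laplaceWeight b c₁ c₂ (s + 1 + 1) z)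
      ≤ (s + 1 - c₁ * c₂) * reducedWeight b c₁ c₂ (s + 1) z := by
    have h := mul_laplaceWeight_le (c₂ := c₂) hc (show 0 < s + 1 by linarith) hb hb1 hz
    have h' := mul_le_mul_of_nonneg_left (reducedLogWeight_le hc hi1 hz) (neg_nonneg.2 hcc.le)
    linarith
  -- With c < 0 the term -cQ₀ is nonnegative and may be dropped. At s = 0, where integration by
  -- parts is not available, the bound is mere positivity.
  have hB : s * reducedWeight b c₁ c₂ s z ≤ z * laplaceWeight b c₁ c₂ (s + 1) z := by
    rcases hs.eq_or_lt with rfl | hs'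
    · rw [zero_mul]
      positivity
    · have h := le_mul_laplaceWeight (c₂ := c₂) hc hs' hb hb1 hz
      have h' := mul_nonneg (neg_nonneg.2 hcc.le)
        (reducedLogWeight_nonneg (b := b) (c₂ := c₂) (s := s) hc hz)
      linarith
  have p0 := reducedWeight_eq hi0 hz
  have p1 := reducedWeight_eq hi1 hz
  have cheb1 := laplaceWeight_zero_mul_le hc hi0 hz
  have hE := Real.exp_pos (-z)
  generalize laplaceWeight b c₁ c₂ (s + 1 + 1) z = M2 at *
  generalize laplaceWeight b c₁ c₂ (s + 1) z = M1 at *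
  generalize laplaceWeight b c₁ c₂ s z = M0 at *
  generalize laplaceWeight b c₁ c₂ (s + 1) 0 = B1 at *
  generalize laplaceWeight b c₁ c₂ s 0 = B0 at *
  generalize reducedWeight b c₁ c₂ (s + 1) z = P1 at *
  generalize reducedWeight b c₁ c₂ s z = P0 at *
  generalize Real.exp (-z) = E at *
  generalize c₁ * c₂ = c at *
  have hA' := mul_le_mul_of_nonneg_right hA m0.le
  have hB'' := mul_le_mul_of_nonneg_left (mul_le_mul_of_nonneg_right hB m1.le) hb.le
  have hs1 : b * (s * (E * (B0 * M1))) ≤ s * (E * (B1 * M0)) := by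
    have hnn : 0 ≤ s * (E * (B0 * M1)) := by positivity
    calc _ ≤ s * (E * (B0 * M1)) := mul_le_of_le_one_left hnn hb1.le
      _ ≤ _ := by gcongr
  have hdM := mul_le_mul_of_nonneg_right hbd (mul_pos m1 m0).le
  -- The exponential remainder is at most -2(s + 1 - c) + s = -(s + 2 - 2c) times E·B1·M0.
  have hEB : 0 ≤ (s + 2 - 2 * c) * (E * (B1 * M0)) :=
    mul_nonneg (by linarith) (by positivity)
  refine le_of_mul_le_mul_left ?_ hb
  subst p0 p1
  linarith

end RiskInequality

/-! ### Minimaxity -/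

section Minimax

variable {a b c₁ c₂ : ℝ}

lemma mixingWeight_kappaPrior (h : ℝ → ℝ) {κ : ℝ} (hκ : 0 < κ) :
    mixingWeight p (kappaPrior a b h) κ = kappaPrior ((p : ℝ) / 2 + a) b h κ :=
  rpow_mul_kappaPrior a _ b h hκ

lemma tiltedMoment_mixingWeight (j : ℕ) (r : ℝ) :
    tiltedMoment (mixingWeight p (kappaPrior a b (logAdj c₁ c₂))) j r
      = laplaceWeight b c₁ c₂ ((p : ℝ) / 2 + a + j) (r / 2) :=
  setIntegral_congr_fun measurableSet_Ioo fun κ hκ => by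
    rw [mixingWeight_kappaPrior _ hκ.1, ← mul_assoc, ← Real.rpow_natCast,
      rpow_mul_kappaPrior _ _ _ _ hκ.1, add_comm (j : ℝ), show κ * r / 2 = r / 2 * κ by ring]

lemma bayesMinimax_of_laplaceWeight_le (hc : 0 < c₁)
    (hi : IntegrableOn (kappaPrior ((p : ℝ) / 2 + a) b (logAdj c₁ c₂)) (Set.Ioo 0 1))
    (h : ∀ z, 0 ≤ z → 2 * z * (laplaceWeight b c₁ c₂ ((p : ℝ) / 2 + a + 1 + 1) z
        * laplaceWeight b c₁ c₂ ((p : ℝ) / 2 + a) z)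
      - z * laplaceWeight b c₁ c₂ ((p : ℝ) / 2 + a + 1) z ^ 2
      ≤ p * (laplaceWeight b c₁ c₂ ((p : ℝ) / 2 + a + 1) z
        * laplaceWeight b c₁ c₂ ((p : ℝ) / 2 + a) z)) :
    BayesMinimax p (kappaPrior a b (logAdj c₁ c₂)) := by
  refine bayesMinimax_of_tiltedMoment_le (measurable_kappaPrior a b c₁ c₂)
    (hi.congr_fun (fun κ hκ => (mixingWeight_kappaPrior _ hκ.1).symm) measurableSet_Ioo)
    (fun κ hκ => (mixingWeight_kappaPrior (p := p) (a := a) (b := b) (logAdj c₁ c₂) hκ.1).symm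
      ▸ kappaPrior_pos hc _ b c₂ hκ) fun r hr => ?_
  have := h (r / 2) (by positivity)
  simp only [tiltedMoment_mixingWeight, Nat.cast_zero, add_zero, Nat.cast_one, Nat.cast_two]
  rw [show (p : ℝ) / 2 + a + 2 = (p : ℝ) / 2 + a + 1 + 1 by ring]
  linarith

/-- Here h ≥ 1, so the integral dominates that of κ⁻¹. For c₂ > 0 this rules out the boundary case a
= -p/2. -/
lemma lintegral_inv_mul_logAdj_eq_top (hc : 0 < c₁) (h2 : 0 ≤ c₂) :
    ∫⁻ κ in Set.Ioo (0 : ℝ) 1, ENNReal.ofReal (κ⁻¹ * logAdj c₁ c₂ κ) = ⊤ := by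
  by_contra hne
  have hle : ∫⁻ κ in Set.Ioo (0 : ℝ) 1, ENNReal.ofReal κ⁻¹
      ≤ ∫⁻ κ in Set.Ioo (0 : ℝ) 1, ENNReal.ofReal (κ⁻¹ * logAdj c₁ c₂ κ) := by
    refine setLIntegral_mono' measurableSet_Ioo fun κ hκ => ENNReal.ofReal_le_ofReal ?_
    exact le_mul_of_one_le_right (inv_nonneg.2 hκ.1.le) (one_le_logAdj hc h2 hκ)
  have hi : IntegrableOn (fun κ : ℝ => κ⁻¹) (Set.Ioo 0 1) := by
    refine ⟨Measurable.aestronglyMeasurable (by fun_prop), ?_⟩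
    rw [hasFiniteIntegral_iff_ofReal]
    · exact hle.trans_lt (lt_top_iff_ne_top.2 hne)
    · filter_upwards [ae_restrict_mem measurableSet_Ioo] with κ hκ using inv_nonneg.2 hκ.1.le
  have := (intervalIntegrable_iff_integrableOn_Ioo_of_le zero_le_one).2 hi
  rw [intervalIntegrable_inv_iff] at this
  simp at this

theorem bayesMinimax_of_pos (hc : 0 < c₁) (ha : -(p : ℝ) / 2 ≤ a) (hap : a < (p : ℝ) / 2 - 2)
    (hfin : a = -(p : ℝ) / 2 →
      (∫⁻ κ in Set.Ioo (0 : ℝ) 1, ENNReal.ofReal (κ⁻¹ * logAdj c₁ c₂ κ)) < ⊤)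
    (h2 : 0 < c₂) (hc2 : c₂ ≤ ((p : ℝ) / 2 + a + 2) / c₁)
    (hb : ((p : ℝ) + 2 * a + 2) / (3 * (p : ℝ) / 2 + a) ≤ b) (hb1 : b < 1) :
    BayesMinimax p (kappaPrior a b (logAdj c₁ c₂)) := by
  have hden : 0 < 3 * (p : ℝ) / 2 + a := by linarith
  have hb0 : 0 < b := lt_of_lt_of_le (div_pos (by linarith) hden) hb
  have hs : 0 < (p : ℝ) / 2 + a := by
    rcases ha.eq_or_lt with h | h
    · have := hfin h.symm
      rw [lintegral_inv_mul_logAdj_eq_top hc h2.le] at this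
      exact absurd this (lt_irrefl _)
    · linarith
  rw [div_le_iff₀ hden] at hb
  rw [le_div_iff₀ hc] at hc2
  -- With s = p/2 + a and d = p, the bound on `b` reads 2(s + 1) ≤ b(d + s).
  exact bayesMinimax_of_laplaceWeight_le hc (integrableOn_kappaPrior hc c₂ hs hb0) fun z hz =>
    laplaceWeight_le_of_pos hc hs hb0 hb1 h2 (by linarith) (by linarith) p.cast_nonneg hz

theorem bayesMinimax_of_neg (hc : 0 < c₁) (ha : -(p : ℝ) / 2 ≤ a) (hap : a < (p : ℝ) / 2 - 2)
    (hfin : a = -(p : ℝ) / 2 →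
      (∫⁻ κ in Set.Ioo (0 : ℝ) 1, ENNReal.ofReal (κ⁻¹ * logAdj c₁ c₂ κ)) < ⊤)
    (h2 : c₂ < 0)
    (hb : ((p : ℝ) + 2 * a + 2 - 2 * c₁ * c₂) / (3 * (p : ℝ) / 2 + a) ≤ b) (hb1 : b < 1) :
    BayesMinimax p (kappaPrior a b (logAdj c₁ c₂)) := by
  have hden : 0 < 3 * (p : ℝ) / 2 + a := by linarith
  have hcc : c₁ * c₂ < 0 := mul_neg_of_pos_of_neg hc h2
  have hb0 : 0 < b := lt_of_lt_of_le (div_pos (by linarith) hden) hb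
  have hi : IntegrableOn (kappaPrior ((p : ℝ) / 2 + a) b (logAdj c₁ c₂)) (Set.Ioo 0 1) := by
    rcases ha.eq_or_lt with h | h
    · rw [show (p : ℝ) / 2 + a = 0 by rw [← h]; ring]
      exact integrableOn_kappaPrior_zero hc hb0 hb1 h2.le (hfin h.symm)
    · exact integrableOn_kappaPrior hc c₂ (by linarith) hb0
  rw [div_le_iff₀ hden] at hb
  exact bayesMinimax_of_laplaceWeight_le hc hi fun z hz =>
    laplaceWeight_le_of_neg hc (by linarith) hb0 hb1 h2 hi (by linarith) hz

lemma lintegral_inv_mul_logAdj_neg_two (hc : 0 < c₁) :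
    ∫⁻ κ in Set.Ioo (0 : ℝ) 1, ENNReal.ofReal (κ⁻¹ * logAdj c₁ (-2) κ) < ⊤ := by
  -- An explicit antiderivative of κ⁻¹(1 + c₁ log(1/κ))⁻². Its value at 0 is reset to the limit 0,
  -- since the convention for log(1/0) would give c₁⁻¹ there.
  let g : ℝ → ℝ := Function.update (fun κ => c₁⁻¹ * logWeight c₁ κ) 0 0
  have hg : ∀ κ : ℝ, κ ≠ 0 → g κ = c₁⁻¹ * logWeight c₁ κ := fun κ h => Function.update_of_ne h _ _
  have hderiv : ∀ κ ∈ Set.Ioc (0 : ℝ) 1, HasDerivAt g (κ⁻¹ * logAdj c₁ (-2) κ) κ := by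
    intro κ hκ
    have h0 := hκ.1
    have hL : 0 < 1 + c₁ * Real.log (1 / κ) := by
      have : 0 ≤ Real.log (1 / κ) := Real.log_nonneg (by rw [le_div_iff₀ h0]; linarith [hκ.2])
      positivity
    have d3 : HasDerivAt (fun κ : ℝ => 1 + c₁ * Real.log (1 / κ)) (c₁ * -κ⁻¹) κ := by
      have : (fun κ : ℝ => 1 + c₁ * Real.log (1 / κ)) = fun κ => 1 + c₁ * -Real.log κ := by
        funext κ; simp
      rw [this]
      exact (((Real.hasDerivAt_log h0.ne').neg).const_mul c₁).const_add 1
    have d4 := (d3.inv hL.ne').const_mul c₁⁻¹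
    refine (d4.congr_of_eventuallyEq ?_).congr_deriv ?_
    · filter_upwards [lt_mem_nhds h0] with x hx using hg x hx.ne'
    · rw [logAdj, Real.rpow_neg hL.le, Real.rpow_two]
      field_simp
  have hcont : ContinuousOn g (Set.Icc 0 1) := by
    intro κ hκ
    rcases hκ.1.eq_or_lt with rfl | h0
    · refine ContinuousAt.continuousWithinAt ?_
      rw [continuousAt_update_same]
      have t1 : Filter.Tendsto (fun κ : ℝ => 1 + c₁ * Real.log (1 / κ)) (nhdsWithin 0 {0}ᶜ)
          Filter.atTop := by
        refine Filter.tendsto_atTop_add_const_left _ _ (Filter.Tendsto.const_mul_atTop hc ?_)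
        simpa [Function.comp_def] using Filter.tendsto_neg_atBot_atTop.comp Real.tendsto_log_nhdsNE_zero
      have t2 := (Filter.Tendsto.inv_tendsto_atTop t1).const_mul c₁⁻¹
      rwa [mul_zero] at t2
    · exact (hderiv κ ⟨h0, hκ.2⟩).continuousAt.continuousWithinAt
  have hnn : ∀ κ ∈ Set.Ioo (0 : ℝ) 1, 0 ≤ κ⁻¹ * logAdj c₁ (-2) κ := fun κ hκ =>
    mul_nonneg (inv_nonneg.2 hκ.1.le) (logAdj_pos hc _ hκ).le
  have hi := (intervalIntegral.integrableOn_deriv_of_nonneg hcont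
    (fun κ hκ => hderiv κ ⟨hκ.1, hκ.2.le⟩) hnn).mono_set Set.Ioo_subset_Ioc_self
  rw [← hasFiniteIntegral_iff_ofReal]
  · exact hi.hasFiniteIntegral
  · filter_upwards [ae_restrict_mem measurableSet_Ioo] with κ hκ using hnn κ hκ

lemma isProper_kappaPrior_neg_two (hc : 0 < c₁) (hb : 0 < b) (hb1 : b < 1) :
    IsProper (kappaPrior 0 b (logAdj c₁ (-2))) := by
  have hi := integrableOn_kappaPrior_zero hc hb hb1 (by norm_num)
    (lintegral_inv_mul_logAdj_neg_two hc)
  have hpos := fun κ hκ => kappaPrior_pos hc 0 b (-2) (κ := κ) hκ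
  have h := tiltedMoment_pos hi hpos 0 0
  simp only [tiltedMoment, pow_zero, one_mul, mul_zero, zero_div, neg_zero, Real.exp_zero,
    mul_one] at h
  rw [IsProper, ← ofReal_integral_eq_lintegral_ofReal hi
    (by filter_upwards [ae_restrict_mem measurableSet_Ioo] with κ hκ using (hpos κ hκ).le)]
  exact ⟨(ENNReal.ofReal_pos.2 h).ne', ENNReal.ofReal_ne_top⟩

end Minimax

end LogAdjusted

theorem mainTheorem4 (p : ℕ) :
    (∀ a b c₁ c₂ : ℝ, 0 < c₁ → -(p : ℝ) / 2 ≤ a → a < (p : ℝ) / 2 - 2 →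
      (a = -(p : ℝ) / 2 →
        (∫⁻ κ in Set.Ioo (0 : ℝ) 1, ENNReal.ofReal (κ⁻¹ * LogAdjusted.logAdj c₁ c₂ κ)) < ⊤) →
      ((0 < c₂ → c₂ ≤ ((p : ℝ) / 2 + a + 2) / c₁ →
          ((p : ℝ) + 2 * a + 2) / (3 * (p : ℝ) / 2 + a) ≤ b → b < 1 →
          LogAdjusted.BayesMinimax p (LogAdjusted.kappaPrior a b (LogAdjusted.logAdj c₁ c₂))) ∧
        (-((p : ℝ) / 2 - a - 2) / (2 * c₁) < c₂ → c₂ < 0 →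
          ((p : ℝ) + 2 * a + 2 - 2 * c₁ * c₂) / (3 * (p : ℝ) / 2 + a) ≤ b → b < 1 →
          LogAdjusted.BayesMinimax p (LogAdjusted.kappaPrior a b (LogAdjusted.logAdj c₁ c₂))))) ∧
    (5 ≤ p → ∀ b : ℝ, (5 * (p : ℝ) + 4) / (6 * (p : ℝ)) ≤ b → b < 1 →
      LogAdjusted.IsProper (LogAdjusted.kappaPrior 0 b (LogAdjusted.logAdj (((p : ℝ) - 4) / 16) (-2))) ∧
        LogAdjusted.BayesMinimax p (LogAdjusted.kappaPrior 0 b (LogAdjusted.logAdj (((p : ℝ) - 4) / 16) (-2)))) := by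
  refine ⟨fun a b c₁ c₂ hc ha hap hfin => ⟨fun h2 hc2 hb hb1 =>
    LogAdjusted.bayesMinimax_of_pos hc ha hap hfin h2 hc2 hb hb1, fun _ h2 hb hb1 =>
    LogAdjusted.bayesMinimax_of_neg hc ha hap hfin h2 hb hb1⟩, fun hp b hb hb1 => ?_⟩
  have hp' : (5 : ℝ) ≤ p := by exact_mod_cast hp
  have hc : 0 < ((p : ℝ) - 4) / 16 := by linarith
  have hb0 : 0 < b := lt_of_lt_of_le (by positivity) hb
  refine ⟨LogAdjusted.isProper_kappaPrior_neg_two hc hb0 hb1,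
    LogAdjusted.bayesMinimax_of_neg hc (by linarith) (by linarith) (fun h => ?_) (by norm_num)
      ?_ hb1⟩
  · linarith
  -- Here -2c₁c₂ = (p - 4)/4, so the general bound (5p/4 + 1)/(3p/2) equals (5p + 4)/(6p).
  · refine le_of_eq_of_le ?_ hb
    field_simp
    ring
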